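/- **Corollary (Multihoming / redundancy).** Let $\lambda_v,\lambda_r,d>0$ and $0<\gamma\le 1$. Vehicles on the real line form a homogeneous Poisson point process of intensity $\lambda_v$. Each vehicle is, independently of the other vehicles and of all locations, V2V-capable with probability $\gamma$ and a (blocking) legacy vehicle otherwise. Road Side Units (RSUs) are located at the points $(k+U)\lambda_r^{-1}$, $k\in\mathbb Z$, where $U$ is uniform on $[0,1)$ and independent of the vehicles. Two capable vehicles are linked if they are at distance at most $d$ and no legacy vehicle lies strictly between them; a cluster is a connected component of the resulting graph on the capable vehicles (possibly a single vehicle); a cluster is connected to an RSU if at least one of its vehicles is at distance at most $d$ from that RSU. Let $M$ be the number of RSUs to which a typical cluster is connected, where "typical" is meant in the Palm sense: $\mathbb E[M]$ is the mean of the total number of connected RSUs summed over the clusters whose rearmost vehicle lies in $[0,1)$, divided by the mean number of such clusters. Then the mean number of clusters per unit length is positive and finite, $\mathbb E[M]$ is finite, and $$\mathbb E[M]\ \ge\ \frac{1-e^{-2\gamma\lambda_v d}}{\gamma\lambda_v\lambda_r^{-1}\left(1-\gamma+\gamma e^{-\gamma\lambda_v d}\right)}.$$ Under full market penetration ($\gamma=1$)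 this becomes $$\mathbb E[M]\ \ge\ \frac{e^{\lambda_v d}-e^{-\lambda_v d}}{\lambda_v\lambda_r^{-1}}=\frac{2\sinh(\lambda_v d)}{\lambda_v\lambda_r^{-1}}.$$ -/

import Mathlib

open MeasureTheory ProbabilityTheory
open scoped ENNReal NNReal

noncomputable section

namespace Highway

/-! ### The geometry of one snapshot of the road

Vehicles are indexed by `ℕ`; vehicle `i` is at `x i : ℝ`, and `c i = true` means that it is
V2V+V2I capable, `c i = false` that it is a legacy vehicle. -/

/-- The V2V link graph with communication range `d`: two distinct capable vehicles are linked when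
they are within distance `d` and no legacy vehicle stands strictly between them (line of sight). -/
def v2vGraph (d : ℝ) (x : ℕ → ℝ) (c : ℕ → Bool) : SimpleGraph ℕ where
  Adj i j := i ≠ j ∧ c i = true ∧ c j = true ∧ |x i - x j| ≤ d ∧
    ∀ k, c k = false → x k ∉ Set.Ioo (min (x i) (x j)) (max (x i) (x j))
  symm := ⟨fun i j h => ⟨h.1.symm, h.2.2.1, h.2.1, by rw [abs_sub_comm]; exact h.2.2.2.1, by
    rw [min_comm, max_comm]; exact h.2.2.2.2⟩⟩
  loopless := ⟨fun _ h => h.1 rfl⟩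

/-- The V2V relay cluster of vehicle `i`: the vehicles joined to `i` by a chain of V2V links. -/
def cluster (d : ℝ) (x : ℕ → ℝ) (c : ℕ → Bool) (i : ℕ) : Set ℕ :=
  {j | (v2vGraph d x c).Reachable i j}

/-- Vehicle `i` is capable and is the rearmost vehicle of its cluster. Its location is the
reference point of the cluster. -/
def IsRear (d : ℝ) (x : ℕ → ℝ) (c : ℕ → Bool) (i : ℕ) : Prop :=
  c i = true ∧ ∀ j ∈ cluster d x c i, x i ≤ x j

/-- The location of the `k`-th Road Side Unit: the RSUs are equally spaced, `lamR⁻¹` apart, with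
phase `u`. -/
def rsuPos (lamR u : ℝ) (k : ℤ) : ℝ := (k + u) * lamR⁻¹

/-- The number of RSUs that the cluster of vehicle `i` is connected to, i.e. that are within
distance `d` of at least one vehicle of the cluster. -/
def numRSU (d lamR : ℝ) (x : ℕ → ℝ) (c : ℕ → Bool) (u : ℝ) (i : ℕ) : ℕ∞ :=
  Set.encard {k : ℤ | ∃ j ∈ cluster d x c i, |x j - rsuPos lamR u k| ≤ d}

open Classical in
/-- The sum of `f` over the clusters whose reference point lies in the unit window `[0, 1)`;
the argument of `f` is the rearmost vehicle of the cluster. -/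
def clusterSum (d : ℝ) (x : ℕ → ℝ) (c : ℕ → Bool) (f : ℕ → ℝ≥0∞) : ℝ≥0∞ :=
  ∑' i : ℕ, if IsRear d x c i ∧ x i ∈ Set.Ico (0 : ℝ) 1 then f i else 0

/-! ### The random model -/

variable {Ω : Type*} [MeasurableSpace Ω]

/-- The number of points of the random sequence `X` that fall in `A`. -/
def count (X : ℕ → Ω → ℝ) (A : Set ℝ) (ω : Ω) : ℕ∞ := Set.encard {i : ℕ | X i ω ∈ A}

/-- The random points `X 0, X 1, …` form a homogeneous Poisson point process of intensity `lam`
on the real line. -/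
structure IsPoissonProcess (P : Measure Ω) (X : ℕ → Ω → ℝ) (lam : ℝ) : Prop where
  measurable : ∀ i, Measurable (X i)
  poisson : ∀ A : Set ℝ, MeasurableSet A → volume A ≠ ∞ → ∀ n : ℕ,
    P {ω | count X A ω = n} = poissonMeasure (lam * (volume A).toReal).toNNReal {n}
  indep : ∀ (n : ℕ) (A : Fin n → Set ℝ), (∀ i, MeasurableSet (A i)) →
    (∀ i j, i ≠ j → Disjoint (A i) (A j)) → iIndepFun (fun i => count X (A i)) P

/-- The highway model: the vehicles form a Poisson point process of intensity `lamV`, each vehicle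
is independently capable with probability `γ`, and the phase of the RSU grid is uniform and
independent of the vehicles. -/
structure IsHighway (P : Measure Ω) (X : ℕ → Ω → ℝ) (B : ℕ → Ω → Bool) (U : Ω → ℝ)
    (lamV γ : ℝ) : Prop where
  poisson : IsPoissonProcess P X lamV
  measurable_mark : ∀ i, Measurable (B i)
  mark : ∀ i, P {ω | B i ω = true} = ENNReal.ofReal γ
  indep_marks : iIndepFun B P
  indep_loc_mark : IndepFun (fun ω i => X i ω) (fun ω i => B i ω) P
  phase : HasLaw U (volume.restrict (Set.Ico (0 : ℝ) 1)) P
  indep_phase : IndepFun (fun ω => ((fun i => X i ω), (fun i => B i ω))) U P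

/-- The intensity of the process of clusters: the mean number of clusters per unit length. -/
def clusterIntensity (P : Measure Ω) (X : ℕ → Ω → ℝ) (B : ℕ → Ω → Bool) (d : ℝ) : ℝ≥0∞ :=
  ∫⁻ ω, clusterSum d (fun i => X i ω) (fun i => B i ω) (fun _ => 1) ∂P

/-- `𝔼[M]`: the mean number of RSUs that a typical cluster is connected to. The typical cluster is
understood in the sense of Palm: the mean total over the clusters with reference point in a unit
window, divided by the mean number of such clusters. -/
def meanRSU (P : Measure Ω) (X : ℕ → Ω → ℝ) (B : ℕ → Ω → Bool) (U : Ω → ℝ) (d lamR : ℝ) : ℝ≥0∞ :=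
  (∫⁻ ω, clusterSum d (fun i => X i ω) (fun i => B i ω)
      (fun i => (numRSU d lamR (fun i => X i ω) (fun i => B i ω) (U ω) i : ℝ≥0∞)) ∂P) /
    clusterIntensity P X B d

end Highway

end

/-! The proof counts pairs (cluster, RSU) in two ways. By definition the numerator of `meanRSU` is
the mean number of connected pairs whose cluster has its rearmost vehicle in [0, 1). The uniform
phase turns the sum over RSUs into `lamR` times an integral over all locations t. By stationarity t
can be moved back into [0, 1) while the window moves instead, and the windows tile the line. So the
numerator equals `lamR` times the average over u in [0, 1) of the mean number of clusters reaching u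
(`lintegral_clusterSum_numRSU`).

That mean is at least the probability that a capable vehicle lies within d of u, which is 1 -
exp(-2γ lamV d) by thinning (`le_lintegral_coverCount`). It is at most the mean number of vehicles
there, which gives finiteness.

For the denominator, a rearmost vehicle is capable, and either no vehicle lies in the interval of
length d behind it or the nearest one there is legacy. This gives `clusterIntensity_le`, with factor
1 - γ + γ exp(-lamV d), which is sharper than needed. The intensity is positive because otherwise
the numerator would vanish.

The vehicles are labelled arbitrarily and only their counts are prescribed, so stationarity needs an
argument. Counts in rational intervals determine a locally finite configuration up to relabelling,
hence label-free functionals have expectations depending only on the intensity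
(`IsPoissonProcess.lintegral_eq`). -/

namespace Highway

/-! ### Geometry of clusters -/

/-- The cluster of vehicle `i` reaches the location `t`. -/
def Covers (d : ℝ) (x : ℕ → ℝ) (c : ℕ → Bool) (i : ℕ) (t : ℝ) : Prop :=
  ∃ j ∈ cluster d x c i, |x j - t| ≤ d

open Classical in
/-- The number of clusters with reference point in `A` that reach the location `t`. -/
noncomputable def coverCount (d : ℝ) (A : Set ℝ) (x : ℕ → ℝ) (c : ℕ → Bool) (t : ℝ) : ℝ≥0∞ :=
  ∑' i : ℕ, if IsRear d x c i ∧ x i ∈ A ∧ Covers d x c i t then 1 else 0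

variable {d : ℝ} {x : ℕ → ℝ} {c : ℕ → Bool}

lemma v2vGraph_add (d : ℝ) (x : ℕ → ℝ) (c : ℕ → Bool) (a : ℝ) :
    v2vGraph d (fun i => x i + a) c = v2vGraph d x c := by
  ext i j
  simp only [v2vGraph, add_sub_add_right_eq_sub, min_add_add_right, max_add_add_right,
    Set.mem_Ioo, add_lt_add_iff_right]

lemma cluster_add (d : ℝ) (x : ℕ → ℝ) (c : ℕ → Bool) (a : ℝ) (i : ℕ) :
    cluster d (fun i => x i + a) c i = cluster d x c i := by
  simp only [cluster, v2vGraph_add]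

lemma isRear_add (d : ℝ) (x : ℕ → ℝ) (c : ℕ → Bool) (a : ℝ) (i : ℕ) :
    IsRear d (fun i => x i + a) c i ↔ IsRear d x c i := by
  simp only [IsRear, cluster_add, add_le_add_iff_right]

lemma covers_add (d : ℝ) (x : ℕ → ℝ) (c : ℕ → Bool) (a : ℝ) (i : ℕ) (t : ℝ) :
    Covers d (fun i => x i + a) c i t ↔ Covers d x c i (t - a) := by
  simp only [Covers, cluster_add]
  refine exists_congr fun j => and_congr_right fun _ => ?_
  rw [show x j + a - t = x j - (t - a) by ring]

lemma coverCount_add (d : ℝ) (A : Set ℝ) (x : ℕ → ℝ) (c : ℕ → Bool) (a t : ℝ) :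
    coverCount d A (fun i => x i + a) c t = coverCount d ((· + a) ⁻¹' A) x c (t - a) := by
  unfold coverCount
  classical
  refine tsum_congr fun i => if_congr ?_ rfl rfl
  rw [isRear_add, covers_add, Set.mem_preimage]

/-- Relabelling the vehicles is an isomorphism of link graphs. -/
def permIso (d : ℝ) (x : ℕ → ℝ) (c : ℕ → Bool) (σ : Equiv.Perm ℕ) :
    v2vGraph d (x ∘ σ) (c ∘ σ) ≃g v2vGraph d x c where
  toEquiv := σ
  map_rel_iff' {i j} := by
    simp only [v2vGraph, Function.comp_apply, ne_eq, EmbeddingLike.apply_eq_iff_eq]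
    rw [← σ.forall_congr_right (q := fun k => c k = false →
      x k ∉ Set.Ioo (min (x (σ i)) (x (σ j))) (max (x (σ i)) (x (σ j))))]

lemma mem_cluster_comp_perm (σ : Equiv.Perm ℕ) (i j : ℕ) :
    j ∈ cluster d (x ∘ σ) (c ∘ σ) i ↔ σ j ∈ cluster d x c (σ i) :=
  (SimpleGraph.Iso.reachable_iff (φ := permIso d x c σ)).symm

lemma isRear_comp_perm (σ : Equiv.Perm ℕ) (i : ℕ) :
    IsRear d (x ∘ σ) (c ∘ σ) i ↔ IsRear d x c (σ i) := by
  simp only [IsRear, mem_cluster_comp_perm, Function.comp_apply]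
  rw [← σ.forall_congr_right (q := fun k => k ∈ cluster d x c (σ i) → x (σ i) ≤ x k)]

lemma covers_comp_perm (σ : Equiv.Perm ℕ) (i : ℕ) (t : ℝ) :
    Covers d (x ∘ σ) (c ∘ σ) i t ↔ Covers d x c (σ i) t := by
  simp only [Covers, mem_cluster_comp_perm, Function.comp_apply]
  exact σ.exists_congr_right (q := fun k => k ∈ cluster d x c (σ i) ∧ |x k - t| ≤ d)

/-- Label invariance is essential: the Poisson hypotheses constrain counts, not the labelling. -/
lemma coverCount_comp_perm (A : Set ℝ) (σ : Equiv.Perm ℕ) (t : ℝ) :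
    coverCount d A (x ∘ σ) (c ∘ σ) t = coverCount d A x c t := by
  classical
  simp only [coverCount, isRear_comp_perm, covers_comp_perm, Function.comp_apply]
  exact σ.tsum_eq (fun k => if IsRear d x c k ∧ x k ∈ A ∧ Covers d x c k t then (1 : ℝ≥0∞) else 0)

lemma self_mem_cluster (i : ℕ) : i ∈ cluster d x c i := SimpleGraph.Reachable.refl _

lemma cluster_eq_of_mem {i j : ℕ} (h : j ∈ cluster d x c i) : cluster d x c j = cluster d x c i :=
  Set.ext fun _ => ⟨fun hk => SimpleGraph.Reachable.trans h hk,
    fun hk => SimpleGraph.Reachable.trans (SimpleGraph.Reachable.symm h) hk⟩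

lemma capable_of_mem_cluster {i j : ℕ} (hi : c i = true) (h : j ∈ cluster d x c i) :
    c j = true := by
  rw [cluster, Set.mem_ofPred_eq, SimpleGraph.reachable_iff_reflTransGen] at h
  induction h with
  | refl => exact hi
  | tail _ h _ => exact h.2.2.1

/-- A cluster does not cross a gap longer than the communication range. -/
lemma lt_of_mem_cluster_of_gap {z : ℝ} (hz : ∀ k, x k ∉ Set.Icc (z - d) z) {i j : ℕ}
    (hi : z < x i) (h : j ∈ cluster d x c i) : z < x j := by
  rw [cluster, Set.mem_ofPred_eq, SimpleGraph.reachable_iff_reflTransGen] at h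
  induction h with
  | refl => exact hi
  | @tail b e _ h ih =>
    by_contra hc
    have h1 := (abs_le.1 h.2.2.2.1).2
    exact hz e ⟨by linarith, not_lt.1 hc⟩

/-- In a locally finite configuration with gaps arbitrarily far behind, the cluster of every
capable vehicle has a rearmost vehicle. -/
lemma exists_isRear_of_gap (hfin : ∀ a b : ℝ, {i | x i ∈ Set.Icc a b}.Finite) {j : ℕ}
    (hj : c j = true) {z : ℝ} (hzj : z < x j) (hz : ∀ k, x k ∉ Set.Icc (z - d) z) :
    ∃ i, IsRear d x c i ∧ j ∈ cluster d x c i := by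
  -- The gap confines the members not ahead of j to [z, x j], so a rearmost one exists among
  -- finitely many.
  have hS : ({k | k ∈ cluster d x c j ∧ x k ≤ x j} : Set ℕ).Finite :=
    (hfin z (x j)).subset fun k hk => ⟨(lt_of_mem_cluster_of_gap hz hzj hk.1).le, hk.2⟩
  obtain ⟨i, hi, hmin⟩ := Set.exists_min_image _ x hS ⟨j, self_mem_cluster j, le_rfl⟩
  refine ⟨i, ⟨capable_of_mem_cluster hj hi.1, fun k hk => ?_⟩, hi.1.symm⟩
  rw [cluster_eq_of_mem hi.1] at hk
  rcases le_total (x k) (x j) with h | h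
  · exact hmin k ⟨hk, h⟩
  · exact hi.2.trans h

/-- The gaps are needed because a cluster extending infinitely far behind has no rearmost vehicle
and would not be counted. -/
lemma one_le_coverCount (hfin : ∀ a b : ℝ, {i | x i ∈ Set.Icc a b}.Finite)
    (hgap : ∀ y : ℝ, ∃ z < y, ∀ k, x k ∉ Set.Icc (z - d) z) {j : ℕ} (hj : c j = true) {t : ℝ}
    (hjt : |x j - t| ≤ d) : 1 ≤ coverCount d Set.univ x c t := by
  classical
  obtain ⟨z, hz, hz'⟩ := hgap (x j)
  obtain ⟨i, hi, hij⟩ := exists_isRear_of_gap hfin hj hz hz'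
  refine le_trans ?_ (ENNReal.le_tsum i)
  rw [if_pos ⟨hi, Set.mem_univ _, j, hij, hjt⟩]

lemma encard_eq_tsum_ite {α : Type*} (p : α → Prop) [DecidablePred p] :
    (({i | p i}.encard : ℕ∞) : ℝ≥0∞) = ∑' i, if p i then 1 else 0 := by
  rw [← ENNReal.tsum_set_one, tsum_subtype {i | p i} (fun _ => (1 : ℝ≥0∞))]
  simp [Set.indicator_apply]

/-- When no two vehicles are at the same place, the clusters reaching `t` are at most as many as
the vehicles within distance `d` of `t`. -/
lemma coverCount_le (hinj : Function.Injective x) (A : Set ℝ) (t : ℝ) :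
    coverCount d A x c t ≤ (({i | x i ∈ Set.Icc (t - d) (t + d)}.encard : ℕ∞) : ℝ≥0∞) := by
  classical
  rw [coverCount, ← encard_eq_tsum_ite, ENat.toENNReal_le]
  -- Each counted cluster is sent to one of its vehicles near t, with 0 as a dummy value otherwise.
  -- A vehicle determines its cluster, and distinct locations make the rearmost vehicle unique, so
  -- this is injective.
  have h : ∀ i, ∃ j, IsRear d x c i ∧ x i ∈ A ∧ Covers d x c i t →
      j ∈ cluster d x c i ∧ |x j - t| ≤ d := fun i => by
    by_cases hi : Covers d x c i t
    · obtain ⟨j, hj⟩ := hi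
      exact ⟨j, fun _ => hj⟩
    · exact ⟨0, fun h => absurd h.2.2 hi⟩
  choose f hf using h
  refine Set.encard_le_encard_of_injOn (f := f) (fun i hi => ?_) (fun i hi k hk hik => ?_)
  · obtain ⟨h1, h2⟩ := abs_le.1 (hf i hi).2
    exact ⟨by linarith, by linarith⟩
  · have e : cluster d x c i = cluster d x c k := by
      rw [← cluster_eq_of_mem (hf i hi).1, hik, cluster_eq_of_mem (hf k hk).1]
    refine hinj (le_antisymm (hi.1.2 k ?_) (hk.1.2 i ?_))
    · rw [e]; exact self_mem_cluster k
    · rw [← e]; exact self_mem_cluster i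

/-- If some vehicle is within the communication range behind a rearmost vehicle, then a legacy
vehicle is. -/
lemma exists_legacy_of_isRear (hfin : ∀ a b : ℝ, {i | x i ∈ Set.Icc a b}.Finite) {i : ℕ}
    (hne : ∃ k, x k ∈ Set.Ico (x i - d) (x i)) :
    ∃ p, p ≠ i ∧ ∀ c : ℕ → Bool, IsRear d x c i → c p = false := by
  have hS : ({k | x k ∈ Set.Ico (x i - d) (x i)} : Set ℕ).Finite :=
    (hfin (x i - d) (x i)).subset fun k hk => ⟨hk.1, hk.2.le⟩
  -- Here p is a nearest vehicle behind i, chosen from the locations alone, so its mark stays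
  -- independent of that of i. Nothing lies strictly between them, so a capable p would be linked to
  -- i.
  obtain ⟨p, hp, hmax⟩ := Set.exists_max_image _ x hS hne
  have hpi : p ≠ i := fun h => by subst h; exact lt_irrefl _ hp.2
  refine ⟨p, hpi, fun c hr => ?_⟩
  by_contra hcp
  have hadj : (v2vGraph d x c).Adj i p := by
    refine ⟨hpi.symm, hr.1, by simpa using hcp, ?_, fun k _ hk => ?_⟩
    · rw [abs_of_pos (by linarith [hp.2])]; linarith [hp.1]
    · rw [min_eq_right hp.2.le, max_eq_left hp.2.le] at hk
      exact absurd (hmax k ⟨hp.1.trans hk.1.le, hk.2⟩) (not_le.2 hk.1)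
  exact absurd (hr.2 p hadj.reachable) (not_le.2 hp.2)

/-! ### Measurability -/

section Measurability

variable {α : Type*} [MeasurableSpace α] {x : α → ℕ → ℝ} {c : α → ℕ → Bool}

lemma measurable_mark_eq (hc : Measurable c) (i : ℕ) (v : Bool) :
    Measurable fun a => c a i = v :=
  measurableSet_setOfPred.1 (((measurable_pi_apply i).comp hc) (measurableSet_singleton v))

lemma measurable_adj (hx : Measurable x) (hc : Measurable c) (d : ℝ) (i j : ℕ) :
    Measurable fun a => (v2vGraph d (x a) (c a)).Adj i j := by
  have hxi : ∀ i, Measurable fun a => x a i := fun i => (measurable_pi_apply i).comp hx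
  have h1 := measurable_mark_eq hc
  have h2 : Measurable fun a => |x a i - x a j| ≤ d :=
    measurableSet_setOfPred.1 (measurableSet_le ((hxi i).sub (hxi j)).abs measurable_const)
  have h3 : ∀ k, Measurable fun a => c a k = false →
      x a k ∉ Set.Ioo (min (x a i) (x a j)) (max (x a i) (x a j)) := fun k =>
    (h1 k false).imp <| Measurable.not <|
      (measurableSet_setOfPred.1 (measurableSet_lt ((hxi i).min (hxi j)) (hxi k))).and
      (measurableSet_setOfPred.1 (measurableSet_lt (hxi k) ((hxi i).max (hxi j))))
  exact (measurable_const (a := i ≠ j)).and ((h1 i true).and ((h1 j true).and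
    (h2.and (Measurable.forall h3))))

/-- Reachability is a countable union over walk lengths, and walks of each length are handled by
peeling off the first edge. -/
lemma measurable_mem_cluster (hx : Measurable x) (hc : Measurable c) (d : ℝ) (i j : ℕ) :
    Measurable fun a => j ∈ cluster d (x a) (c a) i := by
  have key : ∀ n i, Measurable fun a =>
      ∃ w : (v2vGraph d (x a) (c a)).Walk i j, w.length = n := by
    intro n
    induction n with
    | zero =>
      intro i
      convert measurable_const (a := i = j) using 2
      refine ⟨fun ⟨w, hw⟩ => SimpleGraph.Walk.eq_of_length_eq_zero hw, ?_⟩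
      rintro rfl
      exact ⟨SimpleGraph.Walk.nil, rfl⟩
    | succ n ih =>
      intro i
      convert Measurable.exists fun k => (measurable_adj hx hc d i k).and (ih k) using 2
      refine ⟨?_, fun ⟨k, h, w, hw⟩ => ⟨w.cons h, by simp [hw]⟩⟩
      rintro ⟨w, hw⟩
      cases w with
      | nil => simp at hw
      | cons h q => exact ⟨_, h, q, by simpa using hw⟩
  convert Measurable.exists fun n => key n i using 2
  exact ⟨fun ⟨w⟩ => ⟨_, w, rfl⟩, fun ⟨_, w, _⟩ => ⟨w⟩⟩

lemma measurable_isRear (hx : Measurable x) (hc : Measurable c) (d : ℝ) (i : ℕ) :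
    Measurable fun a => IsRear d (x a) (c a) i := by
  have hxi : ∀ i, Measurable fun a => x a i := fun i => (measurable_pi_apply i).comp hx
  exact (measurable_mark_eq hc i true).and (Measurable.forall fun j =>
    (measurable_mem_cluster hx hc d i j).imp
      (measurableSet_setOfPred.1 (measurableSet_le (hxi i) (hxi j))))

lemma measurable_covers (hx : Measurable x) (hc : Measurable c) {t : α → ℝ} (ht : Measurable t)
    (d : ℝ) (i : ℕ) : Measurable fun a => Covers d (x a) (c a) i (t a) := by
  have hxi : ∀ i, Measurable fun a => x a i := fun i => (measurable_pi_apply i).comp hx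
  exact Measurable.exists fun j => (measurable_mem_cluster hx hc d i j).and
    (measurableSet_setOfPred.1 (measurableSet_le ((hxi j).sub ht).abs measurable_const))

lemma measurableSet_isRear_and_mem (hx : Measurable x) (hc : Measurable c) (d : ℝ) {A : Set ℝ}
    (hA : MeasurableSet A) (i : ℕ) : MeasurableSet {a | IsRear d (x a) (c a) i ∧ x a i ∈ A} :=
  measurableSet_setOfPred.2 <| (measurable_isRear hx hc d i).and <|
    measurableSet_setOfPred.1 (((measurable_pi_apply i).comp hx) hA)

lemma measurable_coverCount (hx : Measurable x) (hc : Measurable c) {t : α → ℝ} (ht : Measurable t)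
    (d : ℝ) {A : Set ℝ} (hA : MeasurableSet A) :
    Measurable fun a => coverCount d A (x a) (c a) (t a) := by
  classical
  refine Measurable.tsum fun i => Measurable.ite ?_ measurable_const measurable_const
  exact measurableSet_setOfPred.2 <| (measurable_isRear hx hc d i).and <|
    (measurableSet_setOfPred.1 (((measurable_pi_apply i).comp hx) hA)).and
      (measurable_covers hx hc ht d i)

end Measurability

end Highway

namespace Highway

/-! ### The Poisson distribution -/

lemma lintegral_poissonMeasure (r : ℝ≥0) (f : ℕ → ℝ≥0∞) :
    ∫⁻ n, f n ∂poissonMeasure r =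
      ∑' n, f n * ENNReal.ofReal (Real.exp (-r) * r ^ n / n.factorial) := by
  simp_rw [lintegral_countable', poissonMeasure_singleton]

lemma tsum_poisson (r : ℝ≥0) :
    ∑' n : ℕ, ENNReal.ofReal (Real.exp (-r) * r ^ n / n.factorial) = 1 := by
  rw [← ENNReal.ofReal_tsum_of_nonneg (fun n => by positivity) (hasSum_one_poissonMeasure r).summable,
    (hasSum_one_poissonMeasure r).tsum_eq, ENNReal.ofReal_one]

lemma lintegral_cast_poissonMeasure (r : ℝ≥0) : ∫⁻ n, (n : ℝ≥0∞) ∂poissonMeasure r = r := by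
  rw [lintegral_poissonMeasure, tsum_eq_zero_add' ENNReal.summable]
  simp only [Nat.cast_zero, zero_mul, zero_add]
  have h : ∀ n : ℕ, ((n + 1 : ℕ) : ℝ≥0∞) *
      ENNReal.ofReal (Real.exp (-r) * r ^ (n + 1) / (n + 1).factorial) =
      r * ENNReal.ofReal (Real.exp (-r) * r ^ n / n.factorial) := fun n => by
    rw [← ENNReal.ofReal_natCast, ← ENNReal.ofReal_mul (by positivity), ← ENNReal.ofReal_coe_nnreal,
      ← ENNReal.ofReal_mul (by positivity), Nat.factorial_succ]
    congr 1
    push_cast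
    field_simp
    ring
  rw [tsum_congr h, ENNReal.tsum_mul_left, tsum_poisson, mul_one]

/-- Each summand is a constant times a Poisson mass of parameter q r. Taken at q = 1 - γ, this
performs the thinning by marks. -/
lemma lintegral_pow_poissonMeasure (r : ℝ≥0) {q : ℝ} (hq : 0 ≤ q) :
    ∫⁻ n, ENNReal.ofReal q ^ n ∂poissonMeasure r = ENNReal.ofReal (Real.exp (-((1 - q) * r))) := by
  rw [lintegral_poissonMeasure]
  have h : ∀ n : ℕ, ENNReal.ofReal q ^ n *
      ENNReal.ofReal (Real.exp (-r) * r ^ n / n.factorial) =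
      ENNReal.ofReal (Real.exp (-((1 - q) * r))) *
        ENNReal.ofReal (Real.exp (-(q.toNNReal * r : ℝ≥0)) * (q.toNNReal * r : ℝ≥0) ^ n /
          n.factorial) := fun n => by
    rw [← ENNReal.ofReal_pow hq, ← ENNReal.ofReal_mul (by positivity),
      ← ENNReal.ofReal_mul (by positivity)]
    congr 1
    rw [NNReal.coe_mul, Real.coe_toNNReal q hq, mul_div_assoc, mul_div_assoc, ← mul_assoc (Real.exp _),
      ← Real.exp_add, mul_pow]
    rw [show -((1 - q) * (r : ℝ)) + -(q * r) = -r by ring]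
    ring
  rw [tsum_congr h, ENNReal.tsum_mul_left, tsum_poisson, mul_one]

/-! ### Counts of a Poisson process -/

section Poisson

variable {Ω : Type*} [MeasurableSpace Ω] {P : Measure Ω} {X : ℕ → Ω → ℝ} {lam : ℝ}

lemma measurable_count (hX : ∀ i, Measurable (X i)) {A : Set ℝ} (hA : MeasurableSet A) :
    Measurable (count X A) :=
  measurable_encard.comp <| measurable_set_iff.2 fun i =>
    measurableSet_setOfPred.1 (hX i hA)

namespace IsPoissonProcess

/-- Only the finite values are prescribed; they already carry total mass one, so the value `⊤` has
mass zero. -/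
lemma map_count [IsProbabilityMeasure P] (h : IsPoissonProcess P X lam) {A : Set ℝ}
    (hA : MeasurableSet A) (hA' : volume A ≠ ∞) :
    P.map (count X A) =
      (poissonMeasure (lam * (volume A).toReal).toNNReal).map (Nat.cast : ℕ → ℕ∞) := by
  have hc := measurable_count h.measurable hA
  set r := (lam * (volume A).toReal).toNNReal
  have hcast : Measurable (Nat.cast : ℕ → ℕ∞) := measurable_from_nat
  have hs : ∀ n : ℕ, P.map (count X A) {(n : ℕ∞)} = (poissonMeasure r).map (Nat.cast : ℕ → ℕ∞)
      {(n : ℕ∞)} := fun n => by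
    rw [Measure.map_apply hc (measurableSet_singleton _),
      Measure.map_apply hcast (measurableSet_singleton _)]
    have : (Nat.cast : ℕ → ℕ∞) ⁻¹' {(n : ℕ∞)} = {n} := by ext; simp
    rw [this, ← h.poisson A hA hA' n]
    rfl
  have hprob : IsProbabilityMeasure (P.map (count X A)) :=
    Measure.isProbabilityMeasure_map hc.aemeasurable
  have hu : (Set.univ : Set ℕ∞) \ {⊤} = ⋃ n : ℕ, {(n : ℕ∞)} := by
    ext k
    induction k using ENat.recTopCoe <;> simp
  have hne : ∀ ν : Measure ℕ∞, IsProbabilityMeasure ν →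
      (∑' n : ℕ, ν {(n : ℕ∞)}) = 1 - ν {⊤} := fun ν _ => by
    rw [← measure_iUnion (fun i j hij => by simpa using hij) (fun _ => measurableSet_singleton _),
      ← hu, measure_sdiff (Set.subset_univ _) (measurableSet_singleton _).nullMeasurableSet
        (measure_ne_top _ _), measure_univ]
  have htop : (poissonMeasure r).map (Nat.cast : ℕ → ℕ∞) {⊤} = 0 := by
    rw [Measure.map_apply hcast (measurableSet_singleton _)]
    have : (Nat.cast : ℕ → ℕ∞) ⁻¹' {⊤} = ∅ := by ext; simp
    rw [this, measure_empty]
  refine Measure.ext_of_singleton fun k => ?_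
  induction k using ENat.recTopCoe with
  | coe n => exact hs n
  | top =>
    have h1 := hne _ hprob
    rw [tsum_congr hs, hne _ (Measure.isProbabilityMeasure_map hcast.aemeasurable), htop,
      tsub_zero] at h1
    have h2 : P.map (count X A) {⊤} ≤ 1 := prob_le_one
    rw [htop]
    by_contra h0
    exact absurd h1 (ENNReal.sub_lt_self ENNReal.one_ne_top one_ne_zero h0).ne'

lemma lintegral_comp_count [IsProbabilityMeasure P] (h : IsPoissonProcess P X lam) {A : Set ℝ}
    (hA : MeasurableSet A) (hA' : volume A ≠ ∞) (f : ℕ∞ → ℝ≥0∞) :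
    ∫⁻ ω, f (count X A ω) ∂P =
      ∫⁻ n, f n ∂poissonMeasure (lam * (volume A).toReal).toNNReal := by
  rw [← lintegral_map (μ := P) (f := f) (measurable_from_top) (measurable_count h.measurable hA),
    h.map_count hA hA', lintegral_map measurable_from_top measurable_from_nat]

lemma lintegral_count [IsProbabilityMeasure P] (h : IsPoissonProcess P X lam) (hlam : 0 ≤ lam)
    {A : Set ℝ} (hA : MeasurableSet A) (hA' : volume A ≠ ∞) :
    ∫⁻ ω, (count X A ω : ℝ≥0∞) ∂P = ENNReal.ofReal lam * volume A := by
  rw [h.lintegral_comp_count hA hA' (fun n => (n : ℝ≥0∞))]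
  simp only [ENat.toENNReal_coe]
  rw [lintegral_cast_poissonMeasure, ← ENNReal.ofReal, ENNReal.ofReal_mul hlam,
    ENNReal.ofReal_toReal hA']

lemma measure_count_eq_zero (h : IsPoissonProcess P X lam) (hlam : 0 ≤ lam)
    {A : Set ℝ} (hA : MeasurableSet A) (hA' : volume A ≠ ∞) :
    P {ω | count X A ω = 0} = ENNReal.ofReal (Real.exp (-(lam * (volume A).toReal))) := by
  have := h.poisson A hA hA' 0
  rw [Nat.cast_zero] at this
  rw [this, poissonMeasure_singleton, Real.coe_toNNReal _ (by positivity)]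
  simp

lemma lintegral_pow_count [IsProbabilityMeasure P] (h : IsPoissonProcess P X lam)
    (hlam : 0 ≤ lam) {A : Set ℝ} (hA : MeasurableSet A) (hA' : volume A ≠ ∞) {q : ℝ}
    (hq : 0 ≤ q) :
    ∫⁻ ω, ENNReal.ofReal q ^ (count X A ω).toNat ∂P =
      ENNReal.ofReal (Real.exp (-((1 - q) * (lam * (volume A).toReal)))) := by
  rw [h.lintegral_comp_count hA hA' (fun n => ENNReal.ofReal q ^ n.toNat)]
  simp only [ENat.toNat_natCast]
  rw [lintegral_pow_poissonMeasure _ hq, Real.coe_toNNReal _ (by positivity)]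

/-- At least two points in a small set are unlikely. -/
lemma measure_two_le_count_le [IsProbabilityMeasure P] (h : IsPoissonProcess P X lam)
    (hlam : 0 ≤ lam) {A : Set ℝ} (hA : MeasurableSet A) (hA' : volume A ≠ ∞) :
    P {ω | 2 ≤ count X A ω} ≤ ENNReal.ofReal ((lam * (volume A).toReal) ^ 2) := by
  have hc := measurable_count h.measurable hA
  set r := lam * (volume A).toReal with hr
  have hr0 : 0 ≤ r := by positivity
  have hs : {ω | 2 ≤ count X A ω} = ({ω | count X A ω = (0 : ℕ)} ∪ {ω | count X A ω = (1 : ℕ)})ᶜ := by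
    ext ω
    simp only [Set.mem_ofPred_eq, Set.mem_compl_iff, Set.mem_union]
    generalize count X A ω = k
    induction k using ENat.recTopCoe with
    | top => simp
    | coe n => norm_cast; omega
  have hm : ∀ n : ℕ, MeasurableSet {ω | count X A ω = n} := fun n => hc (measurableSet_singleton _)
  rw [hs, prob_compl_eq_one_sub ((hm 0).union (hm 1)), measure_union _ (hm 1), h.poisson A hA hA' 0,
    h.poisson A hA hA' 1, poissonMeasure_singleton, poissonMeasure_singleton,
    Real.coe_toNNReal _ hr0, ← ENNReal.ofReal_add (by positivity) (by positivity),
    ← ENNReal.ofReal_one, ← ENNReal.ofReal_sub _ (by positivity)]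
  · refine ENNReal.ofReal_le_ofReal ?_
    simp only [pow_zero, pow_one, Nat.factorial, Nat.cast_one, mul_one, div_one]
    -- Since exp(-r) ≥ 1 - r, one gets 1 - (1 + r) exp(-r) ≤ 1 - (1 + r)(1 - r) = r².
    have := Real.one_sub_le_exp_neg r
    nlinarith
  · rw [Set.disjoint_left]
    intro ω h1 h2
    simp only [Set.mem_ofPred_eq] at h1 h2
    rw [h1] at h2
    exact absurd h2 (by norm_num)

lemma indepFun_count (h : IsPoissonProcess P X lam) {A C : Set ℝ} (hA : MeasurableSet A)
    (hC : MeasurableSet C) (hAC : Disjoint A C) : IndepFun (count X A) (count X C) P := by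
  have := h.indep 2 ![A, C] (by simp [Fin.forall_fin_two, hA, hC])
    (by simp [Fin.forall_fin_two, hAC, hAC.symm])
  exact this.indepFun (i := 0) (j := 1) (by simp)

lemma lintegral_count_mul_indicator [IsProbabilityMeasure P] (h : IsPoissonProcess P X lam)
    (hlam : 0 ≤ lam) {A C : Set ℝ} (hA : MeasurableSet A) (hA' : volume A ≠ ∞)
    (hC : MeasurableSet C) (hC' : volume C ≠ ∞) (hAC : Disjoint A C) :
    ∫⁻ ω, (count X A ω : ℝ≥0∞) * {ω | count X C ω = 0}.indicator 1 ω ∂P =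
      ENNReal.ofReal lam * volume A *
        ENNReal.ofReal (Real.exp (-(lam * (volume C).toReal))) := by
  have hi : IndepFun (fun ω => (count X A ω : ℝ≥0∞))
      (fun ω => ({0} : Set ℕ∞).indicator (1 : ℕ∞ → ℝ≥0∞) (count X C ω)) P :=
    (h.indepFun_count hA hC hAC).comp (φ := fun n : ℕ∞ => (n : ℝ≥0∞))
      (ψ := ({0} : Set ℕ∞).indicator (1 : ℕ∞ → ℝ≥0∞)) measurable_from_top measurable_from_top
  have hmA : Measurable fun ω => (count X A ω : ℝ≥0∞) :=
    Measurable.comp (g := fun n : ℕ∞ => (n : ℝ≥0∞)) measurable_from_top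
      (measurable_count h.measurable hA)
  have hmC : Measurable fun ω => ({0} : Set ℕ∞).indicator (1 : ℕ∞ → ℝ≥0∞) (count X C ω) :=
    Measurable.comp (g := ({0} : Set ℕ∞).indicator (1 : ℕ∞ → ℝ≥0∞)) measurable_from_top
      (measurable_count h.measurable hC)
  have := lintegral_mul_eq_lintegral_mul_lintegral_of_indepFun hmA hmC hi
  rw [h.lintegral_count hlam hA hA'] at this
  have h2 : ∀ ω, ({0} : Set ℕ∞).indicator (1 : ℕ∞ → ℝ≥0∞) (count X C ω) =
      {ω | count X C ω = 0}.indicator 1 ω := fun ω => by simp [Set.indicator_apply]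
  simp only [Pi.mul_apply, h2] at this
  have hm0 : MeasurableSet {ω | count X C ω = 0} :=
    measurable_count h.measurable hC (measurableSet_singleton 0)
  rw [this, lintegral_indicator_one hm0, h.measure_count_eq_zero hlam hC hC']

/-! ### Almost sure properties of the configuration -/

lemma ae_finite [IsProbabilityMeasure P] (h : IsPoissonProcess P X lam) (hlam : 0 ≤ lam) :
    ∀ᵐ ω ∂P, ∀ a b : ℝ, {i | X i ω ∈ Set.Icc a b}.Finite := by
  have h1 : ∀ n : ℕ, ∀ᵐ ω ∂P, count X (Set.Icc (-n : ℝ) n) ω ≠ ⊤ := fun n => by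
    have hv : volume (Set.Icc (-n : ℝ) n) ≠ ∞ := by simp
    have hm : Measurable fun ω => (count X (Set.Icc (-n : ℝ) n) ω : ℝ≥0∞) :=
      Measurable.comp (g := fun n : ℕ∞ => (n : ℝ≥0∞)) measurable_from_top
        (measurable_count h.measurable measurableSet_Icc)
    have := ae_lt_top hm (by
      rw [h.lintegral_count hlam measurableSet_Icc hv]
      exact ENNReal.mul_ne_top ENNReal.ofReal_ne_top hv)
    filter_upwards [this] with ω hω
    simpa using hω.ne
  filter_upwards [ae_all_iff.2 h1] with ω hω a b
  obtain ⟨n, hn⟩ := exists_nat_ge (max (-a) b)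
  refine (Set.encard_ne_top_iff.1 (hω n)).subset fun i hi => ⟨?_, ?_⟩
  · linarith [hi.1, le_max_left (-a) b]
  · linarith [hi.2, le_max_right (-a) b]

end IsPoissonProcess

/-- The `k`-th cell of length `1 / n` to the right of `a`. -/
def cell (a : ℝ) (n k : ℕ) : Set ℝ := Set.Ico (a + k / n) (a + k / n + 1 / n)

lemma measurableSet_cell (a : ℝ) (n k : ℕ) : MeasurableSet (cell a n k) := measurableSet_Ico

lemma volume_cell (a : ℝ) (n k : ℕ) : volume (cell a n k) = ENNReal.ofReal (1 / n) := by
  rw [cell, Real.volume_Ico]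
  congr 1
  ring

lemma exists_mem_cell {a y : ℝ} {n : ℕ} (hn : 0 < n) (hy : y ∈ Set.Ico a (a + 1)) :
    ∃ k < n, y ∈ cell a n k := by
  have hn' : (0 : ℝ) < n := by exact_mod_cast hn
  have h0 : 0 ≤ n * (y - a) := mul_nonneg hn'.le (by linarith [hy.1])
  refine ⟨⌊n * (y - a)⌋₊, ?_, ?_, ?_⟩
  · rw [Nat.floor_lt h0]
    nlinarith [hy.2]
  · have := Nat.floor_le h0
    have h2 : (⌊n * (y - a)⌋₊ : ℝ) / n ≤ y - a := by
      rw [div_le_iff₀ hn']; linarith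
    linarith
  · have := Nat.lt_floor_add_one (n * (y - a))
    have h2 : y - a < (⌊n * (y - a)⌋₊ + 1 : ℝ) / n := by
      rw [lt_div_iff₀ hn']; linarith
    rw [add_div] at h2
    linarith

namespace IsPoissonProcess

/-- Coinciding vehicles share a cell at every mesh. Among n + 1 cells of a unit interval this has
probability at most (n + 1)(lam / (n + 1))², which tends to 0. -/
lemma ae_injective [IsProbabilityMeasure P] (h : IsPoissonProcess P X lam) (hlam : 0 ≤ lam) :
    ∀ᵐ ω ∂P, Function.Injective fun i => X i ω := by
  have key : ∀ z : ℤ, P (⋂ n : ℕ, ⋃ k ∈ Finset.range (n + 1),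
      {ω | 2 ≤ count X (cell z (n + 1) k) ω}) = 0 := fun z => by
    have hb : ∀ n : ℕ, P (⋂ n : ℕ, ⋃ k ∈ Finset.range (n + 1),
        {ω | 2 ≤ count X (cell z (n + 1) k) ω}) ≤ ENNReal.ofReal (lam ^ 2 * (1 / ((n : ℝ) + 1))) :=
      fun n => by
      calc _ ≤ P (⋃ k ∈ Finset.range (n + 1), {ω | 2 ≤ count X (cell z (n + 1) k) ω}) :=
            measure_mono (Set.iInter_subset _ n)
        _ ≤ ∑ k ∈ Finset.range (n + 1), P {ω | 2 ≤ count X (cell z (n + 1) k) ω} :=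
            measure_biUnion_finset_le _ _
        _ ≤ ∑ k ∈ Finset.range (n + 1), ENNReal.ofReal ((lam * (1 / ((n : ℝ) + 1))) ^ 2) := by
            refine Finset.sum_le_sum fun k _ => ?_
            have hv := volume_cell z (n + 1) k
            have := h.measure_two_le_count_le hlam (measurableSet_cell z (n + 1) k)
              (by rw [hv]; exact ENNReal.ofReal_ne_top)
            rw [hv, ENNReal.toReal_ofReal (by positivity)] at this
            push_cast at this
            exact_mod_cast this
        _ = ENNReal.ofReal (lam ^ 2 * (1 / ((n : ℝ) + 1))) := by
            rw [Finset.sum_const, Finset.card_range, nsmul_eq_mul, ← ENNReal.ofReal_natCast,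
              ← ENNReal.ofReal_mul (by positivity)]
            congr 1
            push_cast
            field_simp
    have ht : Filter.Tendsto (fun n : ℕ => ENNReal.ofReal (lam ^ 2 * (1 / ((n : ℝ) + 1))))
        Filter.atTop (nhds 0) := by
      rw [← ENNReal.ofReal_zero]
      refine ENNReal.tendsto_ofReal ?_
      simpa using tendsto_one_div_add_atTop_nhds_zero_nat.const_mul (lam ^ 2)
    exact le_antisymm (ge_of_tendsto' ht hb) zero_le
  have key' : ∀ᵐ ω ∂P, ∀ z : ℤ, ω ∉ ⋂ n : ℕ, ⋃ k ∈ Finset.range (n + 1),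
      {ω | 2 ≤ count X (cell z (n + 1) k) ω} :=
    ae_all_iff.2 fun z => measure_eq_zero_iff_ae_notMem.1 (key z)
  filter_upwards [key'] with ω hω i j hij
  by_contra hne
  refine hω ⌊X i ω⌋ (Set.mem_iInter.2 fun n => ?_)
  obtain ⟨k, hk, hik⟩ := exists_mem_cell (a := (⌊X i ω⌋ : ℤ)) (n := n + 1) n.succ_pos
    ⟨Int.floor_le (X i ω), Int.lt_floor_add_one _⟩
  refine Set.mem_biUnion (Finset.mem_coe.2 (Finset.mem_range.2 hk)) ?_
  have hij' : X i ω = X j ω := hij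
  have : ({i, j} : Set ℕ) ⊆ {l | X l ω ∈ cell (⌊X i ω⌋ : ℤ) (n + 1) k} := by
    rintro l (rfl | rfl)
    · exact hik
    · show X l ω ∈ cell (⌊X i ω⌋ : ℤ) (n + 1) k
      rw [← hij']
      exact hik
  have h2 := Set.encard_le_encard this
  rwa [Set.encard_pair hne] at h2

/-- Almost surely there are gaps longer than `d` arbitrarily far behind. -/
lemma ae_exists_gap [IsProbabilityMeasure P] (h : IsPoissonProcess P X lam) (hlam : 0 ≤ lam)
    {d : ℝ} (hd : 0 < d) :
    ∀ᵐ ω ∂P, ∀ y : ℝ, ∃ z < y, ∀ k, X k ω ∉ Set.Icc (z - d) z := by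
  -- These disjoint blocks recede to -∞ and are independently empty with the same positive
  -- probability; length d + 1 leaves room for a closed gap of length d.
  set D : ℕ → Set ℝ := fun k => Set.Ico (-((k + 1) * (d + 1))) (-(k * (d + 1))) with hD
  have hDm : ∀ k, MeasurableSet (D k) := fun k => measurableSet_Ico
  have hDv : ∀ k, volume (D k) = ENNReal.ofReal (d + 1) := fun k => by
    rw [hD, Real.volume_Ico]; congr 1; ring
  have hDd : ∀ i j, i ≠ j → Disjoint (D i) (D j) := by
    have aux : ∀ i j, i < j → Disjoint (D i) (D j) := fun i j hij => by
      rw [Set.disjoint_left]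
      intro t h1 h2
      have : (i : ℝ) + 1 ≤ j := by exact_mod_cast hij
      have h3 := h1.1
      have h4 := h2.2
      nlinarith
    intro i j hij
    rcases lt_or_gt_of_ne hij with h | h
    · exact aux i j h
    · exact (aux j i h).symm
  set p := ENNReal.ofReal (Real.exp (-(lam * (d + 1)))) with hp
  have hp0 : p ≠ 0 := by rw [hp]; simp [Real.exp_pos]
  have h0 : ∀ k, P {ω | count X (D k) ω ≠ 0} = 1 - p := fun k => by
    have h1 := h.measure_count_eq_zero hlam (hDm k) (by rw [hDv]; exact ENNReal.ofReal_ne_top)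
    rw [hDv, ENNReal.toReal_ofReal (by positivity)] at h1
    have hm0 : MeasurableSet {ω | count X (D k) ω = 0} :=
      measurable_count h.measurable (hDm k) (measurableSet_singleton 0)
    rw [hp, ← h1, ← prob_compl_eq_one_sub hm0]
    rfl
  have key : ∀ m : ℕ, P (⋂ k : ℕ, {ω | count X (D (m + k)) ω ≠ 0}) = 0 := fun m => by
    have hb : ∀ n : ℕ, P (⋂ k : ℕ, {ω | count X (D (m + k)) ω ≠ 0}) ≤ (1 - p) ^ n := fun n => by
      have hi := h.indep n (fun i => D (m + i)) (fun i => hDm _)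
        (fun i j hij => hDd _ _ (by simpa [Fin.ext_iff] using hij))
      have := hi.measure_inter_preimage_eq_mul Finset.univ
        (sets := fun _ => ({0} : Set ℕ∞)ᶜ) (fun _ _ => (measurableSet_singleton _).compl)
      calc _ ≤ P (⋂ i ∈ (Finset.univ : Finset (Fin n)), count X (D (m + i)) ⁻¹' {0}ᶜ) :=
            measure_mono fun ω hω => by
              simp only [Set.mem_iInter] at hω ⊢
              exact fun i _ => hω i
        _ = (1 - p) ^ n := by
            rw [this]
            have : ∀ i : Fin n, P (count X (D (m + i)) ⁻¹' {0}ᶜ) = 1 - p := fun i => h0 (m + i)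
            rw [Finset.prod_congr rfl fun i _ => this i, Finset.prod_const, Finset.card_univ,
              Fintype.card_fin]
    refine le_antisymm (ge_of_tendsto' (ENNReal.tendsto_pow_atTop_nhds_zero_of_lt_one ?_) hb)
      zero_le
    exact ENNReal.sub_lt_self ENNReal.one_ne_top one_ne_zero hp0
  have key' : ∀ᵐ ω ∂P, ∀ m : ℕ, ω ∉ ⋂ k : ℕ, {ω | count X (D (m + k)) ω ≠ 0} :=
    ae_all_iff.2 fun m => measure_eq_zero_iff_ae_notMem.1 (key m)
  filter_upwards [key'] with ω hω y
  obtain ⟨m, hm⟩ := exists_nat_ge (-y)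
  have := hω m
  simp only [Set.mem_iInter, Set.mem_ofPred_eq, not_forall, not_not] at this
  obtain ⟨k, hk⟩ := this
  have hmk : ((m + k : ℕ) : ℝ) ≥ m := by push_cast; linarith [k.cast_nonneg (α := ℝ)]
  have hmk0 : 0 ≤ ((m + k : ℕ) : ℝ) := Nat.cast_nonneg _
  -- With this z, the point z - d is the left end of the empty block; the extra 1 keeps z off its
  -- right end and strictly below y.
  refine ⟨-((m + k : ℕ) * (d + 1)) - 1, by nlinarith, fun l hl => ?_⟩
  have hmem : l ∈ {i | X i ω ∈ D (m + k)} := by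
    refine ⟨?_, ?_⟩
    · linarith [hl.1]
    · linarith [hl.2]
  have := Set.encard_eq_zero.1 hk
  rw [this] at hmem
  exact hmem

end IsPoissonProcess

end Poisson

end Highway

namespace Highway

/-! ### The law of a Poisson process is determined by its intensity -/

section Uniqueness

variable {Ω Ω' : Type*} [MeasurableSpace Ω] [MeasurableSpace Ω'] {P : Measure Ω} {P' : Measure Ω'}
  {X : ℕ → Ω → ℝ} {Y : ℕ → Ω' → ℝ} {lam : ℝ}

/-- The atom of the algebra generated by the sets `A q` that lies inside `A q` exactly for the
`q` selected by `f`. -/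
def atom {T : Type*} (A : T → Set ℝ) (f : T → Bool) : Set ℝ := {t | ∀ q, t ∈ A q ↔ f q = true}

lemma measurableSet_atom {T : Type*} [Fintype T] {A : T → Set ℝ} (hA : ∀ q, MeasurableSet (A q))
    (f : T → Bool) : MeasurableSet (atom A f) :=
  measurableSet_setOfPred.2 <| Measurable.forall fun q =>
    (measurableSet_setOfPred.1 (hA q)).iff measurable_const

lemma disjoint_atom {T : Type*} (A : T → Set ℝ) {f g : T → Bool} (hfg : f ≠ g) :
    Disjoint (atom A f) (atom A g) := by
  rw [Set.disjoint_left]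
  refine fun t hf hg => hfg (funext fun q => ?_)
  rw [Bool.eq_iff_iff, ← hf q, ← hg q]

/-- The atom outside every `A q` is left out: its volume may be infinite, where no Poisson law is
given. -/
lemma count_eq_sum_atom {Ω : Type*} {X : ℕ → Ω → ℝ} {T : Type*} [Fintype T] [DecidableEq T]
    (A : T → Set ℝ) (q : T) (ω : Ω) :
    count X (A q) ω =
      ∑ f : {f : T → Bool // ∃ q, f q = true}, if f.1 q = true then count X (atom A f.1) ω else 0 := by
  have h : {i | X i ω ∈ A q} = ⋃ f : {f : T → Bool // ∃ q, f q = true},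
      {i | f.1 q = true ∧ X i ω ∈ atom A f.1} := by
    ext i
    simp only [Set.mem_ofPred_eq, Set.mem_iUnion]
    constructor
    · intro hi
      classical
      refine ⟨⟨fun q => decide (X i ω ∈ A q), q, by simpa using hi⟩, by simpa using hi, ?_⟩
      intro q
      simp
    · rintro ⟨f, hf, hi⟩
      exact (hi q).2 hf
  rw [count, h, Set.encard_iUnion_of_finite, finsum_eq_sum_of_fintype]
  · refine Finset.sum_congr rfl fun f _ => ?_
    by_cases hf : f.1 q = true <;> simp [hf, count]
  · intro f g hfg
    refine Set.disjoint_left.2 fun i hi hi' => ?_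
    exact Set.disjoint_left.1 (disjoint_atom A (fun h => hfg (Subtype.ext h))) hi.2 hi'.2

/-- The joint law of the counts of finitely many sets depends only on the intensity. -/
lemma IsPoissonProcess.map_counts_eq [IsProbabilityMeasure P] [IsProbabilityMeasure P']
    (hX : IsPoissonProcess P X lam) (hY : IsPoissonProcess P' Y lam) {T : Type*} [Fintype T]
    {A : T → Set ℝ} (hA : ∀ q, MeasurableSet (A q)) (hA' : ∀ q, volume (A q) ≠ ∞) :
    P.map (fun ω q => count X (A q) ω) = P'.map (fun ω q => count Y (A q) ω) := by
  classical
  let S := {f : T → Bool // ∃ q, f q = true}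
  let e := Fintype.equivFin S
  let D : Fin (Fintype.card S) → Set ℝ := fun i => atom A (e.symm i).1
  have hD : ∀ i, MeasurableSet (D i) := fun i => measurableSet_atom hA _
  have hDv : ∀ i, volume (D i) ≠ ∞ := fun i => by
    obtain ⟨q, hq⟩ := (e.symm i).2
    exact measure_ne_top_of_subset (fun t ht => (ht q).2 hq) (hA' q)
  have hDd : ∀ i j, i ≠ j → Disjoint (D i) (D j) := fun i j hij =>
    disjoint_atom A fun h => hij (e.symm.injective (Subtype.ext h))
  -- Disjoint atoms have independent Poisson counts, so both joint laws are the same product; the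
  -- counts of the `A q` are then a fixed function Ψ of these.
  have hjoint : P.map (fun ω i => count X (D i) ω) = P'.map (fun ω i => count Y (D i) ω) := by
    rw [(iIndepFun_iff_map_fun_eq_pi_map
        (fun i => (measurable_count hX.measurable (hD i)).aemeasurable)).1 (hX.indep _ D hD hDd),
      (iIndepFun_iff_map_fun_eq_pi_map
        (fun i => (measurable_count hY.measurable (hD i)).aemeasurable)).1 (hY.indep _ D hD hDd)]
    congr 1
    funext i
    rw [hX.map_count (hD i) (hDv i), hY.map_count (hD i) (hDv i)]
  let Ψ : (Fin (Fintype.card S) → ℕ∞) → T → ℕ∞ := fun n q =>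
    ∑ i, if (e.symm i).1 q = true then n i else 0
  have hΨ : Measurable Ψ := Measurable.of_discrete
  have hmX : Measurable fun ω i => count X (D i) ω :=
    measurable_pi_lambda _ fun i => measurable_count hX.measurable (hD i)
  have hmY : Measurable fun ω i => count Y (D i) ω :=
    measurable_pi_lambda _ fun i => measurable_count hY.measurable (hD i)
  have h1 : (fun ω q => count X (A q) ω) = Ψ ∘ fun ω i => count X (D i) ω := by
    funext ω q
    rw [count_eq_sum_atom, ← e.symm.sum_comp]
    rfl
  have h2 : (fun ω q => count Y (A q) ω) = Ψ ∘ fun ω i => count Y (D i) ω := by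
    funext ω q
    rw [count_eq_sum_atom, ← e.symm.sum_comp]
    rfl
  rw [h1, h2, ← Measure.map_map hΨ hmX, ← Measure.map_map hΨ hmY, hjoint]

/-- The number of points of a configuration in each interval with rational endpoints. -/
noncomputable def rationalCounts (x : ℕ → ℝ) (p : ℚ × ℚ) : ℕ∞ :=
  {i | x i ∈ Set.Ioo (p.1 : ℝ) p.2}.encard

lemma measurable_rationalCounts : Measurable rationalCounts :=
  measurable_pi_lambda _ fun _ => measurable_encard.comp <| measurable_set_iff.2 fun i =>
    measurableSet_setOfPred.1 (measurable_pi_apply i measurableSet_Ioo)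

/-- Finite-dimensional marginals determine a probability measure on the product. -/
lemma IsPoissonProcess.map_rationalCounts_eq [IsProbabilityMeasure P] [IsProbabilityMeasure P']
    (hX : IsPoissonProcess P X lam) (hY : IsPoissonProcess P' Y lam) :
    P.map (fun ω => rationalCounts fun i => X i ω) =
      P'.map (fun ω => rationalCounts fun i => Y i ω) := by
  have hmX : Measurable fun ω => rationalCounts fun i => X i ω :=
    measurable_rationalCounts.comp (measurable_pi_lambda _ hX.measurable)
  have hmY : Measurable fun ω => rationalCounts fun i => Y i ω :=
    measurable_rationalCounts.comp (measurable_pi_lambda _ hY.measurable)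
  have := Measure.isProbabilityMeasure_map (μ := P) hmX.aemeasurable
  refine IsProjectiveLimit.unique (P := fun I : Finset (ℚ × ℚ) =>
    (P.map (fun ω => rationalCounts fun i => X i ω)).map I.restrict) (fun _ => rfl) fun I => ?_
  have hr : Measurable (I.restrict (π := fun _ : ℚ × ℚ => ℕ∞)) := Finset.measurable_restrict I
  show _ = (P.map (fun ω => rationalCounts fun i => X i ω)).map I.restrict
  rw [Measure.map_map hr hmX, Measure.map_map hr hmY]
  exact (hX.map_counts_eq hY (A := fun q : I => Set.Ioo (q.1.1 : ℝ) q.1.2)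
    (fun _ => measurableSet_Ioo) (fun _ => by simp)).symm

lemma finite_fiber_of_rationalCounts {x : ℕ → ℝ} (hx : ∀ p, rationalCounts x p ≠ ⊤) (a b : ℝ) :
    {i | x i ∈ Set.Icc a b}.Finite := by
  obtain ⟨p, hp⟩ := exists_rat_lt a
  obtain ⟨q, hq⟩ := exists_rat_gt b
  exact (Set.encard_ne_top_iff.1 (hx (p, q))).subset fun i hi =>
    ⟨hp.trans_le hi.1, hi.2.trans_lt hq⟩

/-- In a locally finite configuration, small intervals isolate the points at `r`. -/
lemma exists_pos_isolating {x : ℕ → ℝ} (hx : ∀ p, rationalCounts x p ≠ ⊤) (r : ℝ) :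
    ∃ ε > 0, ∀ i, |x i - r| < ε → x i = r := by
  have hfin := finite_fiber_of_rationalCounts hx (r - 1) (r + 1)
  have hcl : IsClosed (x '' {i | x i ∈ Set.Icc (r - 1) (r + 1)} \ {r}) :=
    ((hfin.image x).subset Set.sdiff_subset).isClosed
  obtain ⟨ε, hε, hb⟩ := Metric.isOpen_iff.1 hcl.isOpen_compl r (by simp)
  refine ⟨min ε 1, by positivity, fun i hi => ?_⟩
  by_contra hne
  have h1 := abs_lt.1 (hi.trans_le (min_le_right _ _))
  have hball : x i ∈ Metric.ball r ε := by
    rw [Metric.mem_ball, Real.dist_eq]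
    exact hi.trans_le (min_le_left _ _)
  refine hb hball ⟨⟨i, ⟨by linarith, by linarith⟩, rfl⟩, hne⟩

/-- Locally finite configurations with the same counts agree up to a relabelling. -/
lemma exists_perm_of_rationalCounts_eq {x y : ℕ → ℝ} (hx : ∀ p, rationalCounts x p ≠ ⊤)
    (h : rationalCounts x = rationalCounts y) : ∃ σ : Equiv.Perm ℕ, y = x ∘ σ := by
  have hy : ∀ p, rationalCounts y p ≠ ⊤ := h ▸ hx
  -- The multiplicity at r is the count of a rational interval isolating r in both configurations.
  -- The resulting bijections of fibres are then glued over all r.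
  have key : ∀ r : ℝ, Nonempty ({i // y i = r} ≃ {i // x i = r}) := fun r => by
    obtain ⟨ε, hε, hex⟩ := exists_pos_isolating hx r
    obtain ⟨δ, hδ, hey⟩ := exists_pos_isolating hy r
    have hm : 0 < min ε δ := lt_min hε hδ
    obtain ⟨p, hp1, hp2⟩ := exists_rat_btwn (show r - min ε δ < r by linarith)
    obtain ⟨q, hq1, hq2⟩ := exists_rat_btwn (show r < r + min ε δ by linarith)
    have aux : ∀ z : ℕ → ℝ, (∀ i, |z i - r| < min ε δ → z i = r) →
        {i | z i ∈ Set.Ioo (p : ℝ) q} = {i | z i = r} := fun z hz => by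
      ext i
      refine ⟨fun hi => hz i (abs_lt.2 ⟨by linarith [hi.1], by linarith [hi.2]⟩), fun hi => ?_⟩
      simp only [Set.mem_ofPred_eq] at hi ⊢
      rw [hi]
      exact ⟨hp2, hq1⟩
    have hxs := aux x fun i hi => hex i (hi.trans_le (min_le_left _ _))
    have hys := aux y fun i hi => hey i (hi.trans_le (min_le_right _ _))
    have hc := congrFun h (p, q)
    simp only [rationalCounts, hxs, hys] at hc
    have fx : {i | x i = r}.Finite := by
      rw [← hxs]; exact Set.encard_ne_top_iff.1 (hx (p, q))
    have fy : {i | y i = r}.Finite := by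
      rw [← hys]; exact Set.encard_ne_top_iff.1 (hy (p, q))
    have : Finite {i // x i = r} := fx
    have : Finite {i // y i = r} := fy
    exact Finite.card_eq.1 (congrArg ENat.toNat hc).symm
  let e : ∀ r : ℝ, {i // y i = r} ≃ {i // x i = r} := fun r => (key r).some
  refine ⟨(Equiv.sigmaFiberEquiv y).symm.trans ((Equiv.sigmaCongrRight e).trans
    (Equiv.sigmaFiberEquiv x)), ?_⟩
  funext i
  exact (e (y i) ⟨i, rfl⟩).2.symm

/-- The expectation of a functional of a Poisson process that does not depend on the labelling
of the points depends only on the intensity. -/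
theorem IsPoissonProcess.lintegral_eq [IsProbabilityMeasure P] [IsProbabilityMeasure P']
    (hX : IsPoissonProcess P X lam) (hY : IsPoissonProcess P' Y lam) (hlam : 0 ≤ lam)
    {G : (ℕ → ℝ) → ℝ≥0∞} (hG : Measurable G)
    (hperm : ∀ (σ : Equiv.Perm ℕ) (x : ℕ → ℝ), G (x ∘ σ) = G x) :
    ∫⁻ ω, G (fun i => X i ω) ∂P = ∫⁻ ω, G (fun i => Y i ω) ∂P' := by
  classical
  -- Equal infinite counts would not yield a relabelling, so G is cut off outside the locally finite
  -- configurations, which have full measure.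
  let good : Set (ℕ → ℝ) := {x | ∀ p, rationalCounts x p ≠ ⊤}
  have hgood : MeasurableSet good := measurableSet_setOfPred.2 <| Measurable.forall fun p =>
    measurableSet_setOfPred.1 (((measurable_pi_apply p).comp measurable_rationalCounts)
      (measurableSet_singleton ⊤).compl)
  let G' : (ℕ → ℝ) → ℝ≥0∞ := good.indicator G
  have hG' : Measurable G' := hG.indicator hgood
  have hfac : ∀ x y, rationalCounts x = rationalCounts y → G' x = G' y := fun x y h => by
    by_cases hx : x ∈ good
    · have hy : y ∈ good := fun p => h ▸ hx p
      obtain ⟨σ, rfl⟩ := exists_perm_of_rationalCounts_eq hx h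
      simp only [G', Set.indicator_of_mem hx, Set.indicator_of_mem hy, hperm]
    · have hy : y ∉ good := fun hy => hx fun p => h ▸ hy p
      simp only [G', Set.indicator_of_notMem hx, Set.indicator_of_notMem hy]
  let g : Set.range rationalCounts → ℝ≥0∞ := fun y => G' y.2.choose
  have hgG : g ∘ Set.rangeFactorization rationalCounts = G' := funext fun x =>
    hfac _ _ (Set.rangeFactorization rationalCounts x).2.choose_spec
  have hmr : Measurable (Set.rangeFactorization rationalCounts) :=
    measurable_rationalCounts.subtype_mk
  -- Although g comes from choice, measurability descends along a measurable surjection from a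
  -- standard Borel space onto a countably separated one.
  have hg : Measurable g :=
    (hmr.measurable_comp_iff_of_surjective Set.rangeFactorization_surjective).1 (hgG ▸ hG')
  have hmX : Measurable fun ω i => X i ω := measurable_pi_lambda _ hX.measurable
  have hmY : Measurable fun ω i => Y i ω := measurable_pi_lambda _ hY.measurable
  have hlaw : P.map (fun ω => Set.rangeFactorization rationalCounts fun i => X i ω) =
      P'.map (fun ω => Set.rangeFactorization rationalCounts fun i => Y i ω) := by
    ext s hs
    obtain ⟨s', hs', rfl⟩ := hs
    have : (P.map fun ω => rationalCounts fun i => X i ω) s' =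
        (P'.map fun ω => rationalCounts fun i => Y i ω) s' := by
      rw [hX.map_rationalCounts_eq hY]
    have hcX : Measurable fun ω => rationalCounts fun i => X i ω :=
      measurable_rationalCounts.comp hmX
    have hcY : Measurable fun ω => rationalCounts fun i => Y i ω :=
      measurable_rationalCounts.comp hmY
    rw [Measure.map_apply hcX hs', Measure.map_apply hcY hs'] at this
    have hrX : Measurable fun ω => Set.rangeFactorization rationalCounts fun i => X i ω :=
      hmr.comp hmX
    have hrY : Measurable fun ω => Set.rangeFactorization rationalCounts fun i => Y i ω :=
      hmr.comp hmY
    rw [Measure.map_apply hrX (measurable_subtype_coe hs'),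
      Measure.map_apply hrY (measurable_subtype_coe hs')]
    exact this
  have hae : ∀ x : ℕ → ℝ, (∀ a b : ℝ, {i | x i ∈ Set.Icc a b}.Finite) → G x = G' x := fun x hx => by
    have hx' : x ∈ good := fun p => Set.encard_ne_top_iff.2 <|
      (hx p.1 p.2).subset fun i hi => ⟨hi.1.le, hi.2.le⟩
    exact (Set.indicator_of_mem hx' G).symm
  calc ∫⁻ ω, G (fun i => X i ω) ∂P
      = ∫⁻ ω, g (Set.rangeFactorization rationalCounts fun i => X i ω) ∂P := by
        refine lintegral_congr_ae ?_
        filter_upwards [hX.ae_finite hlam] with ω hω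
        rw [hae _ hω, ← hgG]
        rfl
    _ = ∫⁻ ω, g (Set.rangeFactorization rationalCounts fun i => Y i ω) ∂P' := by
        rw [← lintegral_map (f := g) hg (hmr.comp hmX), ← lintegral_map (f := g) hg (hmr.comp hmY)]
        exact congrArg (fun ν => lintegral ν g) hlaw
    _ = ∫⁻ ω, G (fun i => Y i ω) ∂P' := by
        refine lintegral_congr_ae ?_
        filter_upwards [hY.ae_finite hlam] with ω hω
        rw [hae _ hω, ← hgG]
        rfl

lemma IsPoissonProcess.add_const (hX : IsPoissonProcess P X lam) (a : ℝ) :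
    IsPoissonProcess P (fun i ω => X i ω + a) lam where
  measurable i := (hX.measurable i).add_const a
  poisson A hA hA' n := by
    have hv : volume ((· + a) ⁻¹' A) = volume A := measure_preimage_add_right volume a A
    have := hX.poisson ((· + a) ⁻¹' A) (measurable_add_const a hA) (hv ▸ hA') n
    rwa [hv] at this
  indep n A hA hAd := hX.indep n (fun i => (· + a) ⁻¹' A i)
    (fun i => measurable_add_const a (hA i)) (fun i j hij => (hAd i j hij).preimage _)

end Uniqueness

/-! ### Stationarity of the highway -/

section Stationarity

variable {Ω : Type*} [MeasurableSpace Ω] {P : Measure Ω}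
  {X : ℕ → Ω → ℝ} {B : ℕ → Ω → Bool} {U : Ω → ℝ} {lamV γ : ℝ}

namespace IsHighway

lemma measurable_loc (h : IsHighway P X B U lamV γ) : Measurable fun ω i => X i ω :=
  measurable_pi_lambda _ h.poisson.measurable

lemma measurable_marks (h : IsHighway P X B U lamV γ) : Measurable fun ω i => B i ω :=
  measurable_pi_lambda _ h.measurable_mark

lemma isProbabilityMeasure_marks [IsProbabilityMeasure P] (h : IsHighway P X B U lamV γ) :
    IsProbabilityMeasure (P.map fun ω i => B i ω) :=
  Measure.isProbabilityMeasure_map h.measurable_marks.aemeasurable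

/-- Integrate out the marks first. -/
lemma lintegral_eq [IsProbabilityMeasure P] (h : IsHighway P X B U lamV γ) {F : (ℕ → ℝ) → (ℕ → Bool) → ℝ≥0∞}
    (hF : Measurable (Function.uncurry F)) :
    ∫⁻ ω, F (fun i => X i ω) (fun i => B i ω) ∂P =
      ∫⁻ ω, ∫⁻ b, F (fun i => X i ω) b ∂(P.map fun ω i => B i ω) ∂P := by
  have := h.isProbabilityMeasure_marks
  have h1 := (indepFun_iff_map_prod_eq_prod_map_map h.measurable_loc.aemeasurable
    h.measurable_marks.aemeasurable).1 h.indep_loc_mark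
  have h2 := lintegral_map (μ := P) hF (h.measurable_loc.prodMk h.measurable_marks)
  rw [h1, lintegral_prod _ hF.aemeasurable,
    lintegral_map (by exact hF.lintegral_prod_right') h.measurable_loc] at h2
  exact h2.symm

lemma map_mark_eq [IsProbabilityMeasure P] (h : IsHighway P X B U lamV γ) (i j : ℕ) : P.map (B i) = P.map (B j) := by
  have hp : ∀ i, IsProbabilityMeasure (P.map (B i)) := fun i =>
    Measure.isProbabilityMeasure_map (h.measurable_mark i).aemeasurable
  have ht : ∀ i, P.map (B i) {true} = ENNReal.ofReal γ := fun i => by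
    rw [Measure.map_apply (h.measurable_mark i) (measurableSet_singleton _), ← h.mark i]
    rfl
  have hf : ∀ i, P.map (B i) {false} = 1 - ENNReal.ofReal γ := fun i => by
    rw [← ht i, ← prob_compl_eq_one_sub (measurableSet_singleton _)]
    congr 1
    ext b
    cases b <;> simp
  refine Measure.ext_of_singleton fun b => ?_
  cases b
  · rw [hf, hf]
  · rw [ht, ht]

lemma map_marks_comp_perm [IsProbabilityMeasure P] (h : IsHighway P X B U lamV γ) (σ : Equiv.Perm ℕ) :
    P.map (fun ω i => B (σ i) ω) = P.map fun ω i => B i ω := by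
  rw [(iIndepFun_iff_map_fun_eq_infinitePi_map fun i => h.measurable_mark (σ i)).1
      (h.indep_marks.precomp σ.injective),
    (iIndepFun_iff_map_fun_eq_infinitePi_map h.measurable_mark).1 h.indep_marks]
  congr 1
  funext i
  exact h.map_mark_eq _ _

/-- Integrating out the i.i.d. marks first leaves a label-free functional of the locations, to which
uniqueness of the Poisson law applies for the shifted process. -/
lemma lintegral_coverCount_add [IsProbabilityMeasure P] (h : IsHighway P X B U lamV γ) (hlam : 0 ≤ lamV) (d : ℝ)
    {A : Set ℝ} (hA : MeasurableSet A) (a t : ℝ) :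
    ∫⁻ ω, coverCount d A (fun i => X i ω) (fun i => B i ω) t ∂P =
      ∫⁻ ω, coverCount d ((· + a) ⁻¹' A) (fun i => X i ω) (fun i => B i ω) (t - a) ∂P := by
  have := h.isProbabilityMeasure_marks
  have hF : ∀ {A : Set ℝ} (_ : MeasurableSet A) (t : ℝ),
      Measurable (Function.uncurry fun x b => coverCount d A x b t) := fun hA t =>
    measurable_coverCount measurable_fst measurable_snd measurable_const d hA
  rw [h.lintegral_eq (hF hA t), h.lintegral_eq (hF (measurable_add_const a hA) (t - a))]
  have := h.poisson.lintegral_eq (h.poisson.add_const a) hlam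
    (G := fun x => ∫⁻ b, coverCount d A x b t ∂(P.map fun ω i => B i ω))
    (hF hA t).lintegral_prod_right' fun σ x => by
      have hmσ : Measurable fun ω i => B (σ i) ω :=
        measurable_pi_lambda _ fun i => h.measurable_mark (σ i)
      have hm : ∀ x : ℕ → ℝ, Measurable fun b => coverCount d A x b t := fun x =>
        measurable_coverCount measurable_const measurable_id measurable_const d hA
      conv_lhs => rw [← h.map_marks_comp_perm σ]
      rw [lintegral_map (hm _) hmσ, lintegral_map (hm _) h.measurable_marks]
      exact lintegral_congr fun ω => coverCount_comp_perm (c := fun i => B i ω) A σ t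
  rw [this]
  exact lintegral_congr fun ω => lintegral_congr fun b => coverCount_add d A _ b a t

end IsHighway

end Stationarity

end Highway

/-! ### Exchange formula between clusters and Road Side Units -/

namespace Highway

lemma lintegral_eq_tsum_Ico (f : ℝ → ℝ≥0∞) :
    ∫⁻ t, f t = ∑' k : ℤ, ∫⁻ u in Set.Ico (0 : ℝ) 1, f (k + u) := by
  have h : ∀ k : ℤ, ∫⁻ t in Set.Ico (k : ℝ) (k + 1), f t =
      ∫⁻ u in Set.Ico (0 : ℝ) 1, f (k + u) := fun k => by
    rw [← lintegral_indicator measurableSet_Ico, ← lintegral_indicator measurableSet_Ico,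
      ← lintegral_add_left_eq_self _ (k : ℝ)]
    refine lintegral_congr fun u => ?_
    simp [Set.indicator_apply]
  rw [← setLIntegral_univ, ← iUnion_Ico_intCast ℝ,
    lintegral_iUnion (fun _ => measurableSet_Ico) (Set.pairwise_disjoint_Ico_intCast ℝ)]
  exact tsum_congr h

lemma lintegral_comp_mul_right {f : ℝ → ℝ≥0∞} (hf : Measurable f) {a : ℝ} (ha : 0 < a) :
    ∫⁻ v, f (v * a⁻¹) = ENNReal.ofReal a * ∫⁻ t, f t := by
  have h := Real.map_volume_mul_right (a := a⁻¹) (inv_ne_zero ha.ne')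
  rw [inv_inv, abs_of_pos ha] at h
  rw [← lintegral_map hf (measurable_mul_const a⁻¹), h, lintegral_smul_measure, smul_eq_mul]

lemma ite_one_zero_congr {p q : Prop} {_ : Decidable p} {_ : Decidable q} (h : p ↔ q) :
    (if p then (1 : ℝ≥0∞) else 0) = if q then 1 else 0 := if_congr h rfl rfl

lemma tsum_coverCount (d : ℝ) (x : ℕ → ℝ) (c : ℕ → Bool) (t : ℝ) :
    ∑' k : ℤ, coverCount d ((· + (k : ℝ)) ⁻¹' Set.Ico 0 1) x c t = coverCount d Set.univ x c t := by
  classical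
  simp only [coverCount]
  rw [ENNReal.tsum_comm]
  refine tsum_congr fun i => ?_
  rw [tsum_eq_single (-⌊x i⌋)]
  · refine ite_one_zero_congr ?_
    have h1 := Int.floor_le (x i)
    have h2 := Int.lt_floor_add_one (x i)
    simp only [Set.mem_preimage, Set.mem_Ico, Set.mem_univ, Int.cast_neg]
    constructor
    · exact fun h => ⟨h.1, trivial, h.2.2⟩
    · exact fun h => ⟨h.1, ⟨by linarith, by linarith⟩, h.2.2⟩
  · intro k hk
    refine if_neg fun h => hk ?_
    have h1 : (0 : ℝ) ≤ x i + k := h.2.1.1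
    have h2 : x i + k < 1 := h.2.1.2
    have : ⌊x i⌋ = -k := Int.floor_eq_iff.2 ⟨by push_cast; linarith, by push_cast; linarith⟩
    omega

lemma clusterSum_numRSU (d lamR : ℝ) (x : ℕ → ℝ) (c : ℕ → Bool) (u : ℝ) :
    clusterSum d x c (fun i => (numRSU d lamR x c u i : ℝ≥0∞)) =
      ∑' k : ℤ, coverCount d (Set.Ico 0 1) x c (rsuPos lamR u k) := by
  classical
  simp only [coverCount]
  rw [ENNReal.tsum_comm, clusterSum]
  refine tsum_congr fun i => ?_
  by_cases hi : IsRear d x c i ∧ x i ∈ Set.Ico (0 : ℝ) 1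
  · rw [if_pos hi, numRSU, encard_eq_tsum_ite]
    refine tsum_congr fun k => ite_one_zero_congr ?_
    exact ⟨fun h => ⟨hi.1, hi.2, h⟩, fun h => h.2.2⟩
  · rw [if_neg hi]
    refine (ENNReal.tsum_eq_zero.2 fun k => if_neg fun h => hi ⟨h.1, h.2.1⟩).symm

section

variable {Ω : Type*} [MeasurableSpace Ω] {P : Measure Ω} [IsProbabilityMeasure P]
  {X : ℕ → Ω → ℝ} {B : ℕ → Ω → Bool} {U : Ω → ℝ} {lamV γ d : ℝ}

namespace IsHighway

lemma measurable_coverCount_uncurry (d : ℝ) {A : Set ℝ} (hA : MeasurableSet A) :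
    Measurable fun p : ((ℕ → ℝ) × (ℕ → Bool)) × ℝ => coverCount d A p.1.1 p.1.2 p.2 :=
  measurable_coverCount (measurable_fst.comp measurable_fst) (measurable_snd.comp measurable_fst)
    measurable_snd d hA

lemma measurable_lintegral_coverCount (h : IsHighway P X B U lamV γ) (d : ℝ) {A : Set ℝ}
    (hA : MeasurableSet A) : Measurable fun t =>
      ∫⁻ ω, coverCount d A (fun i => X i ω) (fun i => B i ω) t ∂P := by
  have : Measurable fun p : ℝ × Ω =>
      coverCount d A (fun i => X i p.2) (fun i => B i p.2) p.1 :=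
    measurable_coverCount (h.measurable_loc.comp measurable_snd)
      (h.measurable_marks.comp measurable_snd) measurable_fst d hA
  exact this.lintegral_prod_right'

/-- The mean number of connected pairs, per unit length, of a cluster and a Road Side Unit. -/
lemma lintegral_clusterSum_numRSU (h : IsHighway P X B U lamV γ) (hlam : 0 ≤ lamV) {lamR : ℝ}
    (hlamR : 0 < lamR) (d : ℝ) :
    ∫⁻ ω, clusterSum d (fun i => X i ω) (fun i => B i ω)
      (fun i => (numRSU d lamR (fun i => X i ω) (fun i => B i ω) (U ω) i : ℝ≥0∞)) ∂P =
    ENNReal.ofReal lamR * ∫⁻ u in Set.Ico (0 : ℝ) 1,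
      ∫⁻ ω, coverCount d Set.univ (fun i => X i ω) (fun i => B i ω) u ∂P := by
  set Φ : Set ℝ → ℝ → ℝ≥0∞ := fun A t =>
    ∫⁻ ω, coverCount d A (fun i => X i ω) (fun i => B i ω) t ∂P with hΦ
  have hXB : Measurable fun ω => ((fun i => X i ω), (fun i => B i ω)) :=
    h.measurable_loc.prodMk h.measurable_marks
  have hprob : IsProbabilityMeasure (P.map U) := Measure.isProbabilityMeasure_map h.phase.aemeasurable
  have hprob' := Measure.isProbabilityMeasure_map (μ := P) hXB.aemeasurable
  have hm := measurable_coverCount_uncurry d (measurableSet_Ico (a := (0 : ℝ)) (b := 1))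
  have hrsu : ∀ k : ℤ, Measurable fun u => rsuPos lamR u k := fun k =>
    (measurable_const.add measurable_id).mul_const _
  have hk : ∀ k : ℤ, ∫⁻ ω, coverCount d (Set.Ico 0 1) (fun i => X i ω) (fun i => B i ω)
      (rsuPos lamR (U ω) k) ∂P = ∫⁻ u in Set.Ico (0 : ℝ) 1, Φ (Set.Ico 0 1) ((k + u) * lamR⁻¹) :=
      fun k => by
    have hmk : Measurable fun p : ((ℕ → ℝ) × (ℕ → Bool)) × ℝ =>
        coverCount d (Set.Ico 0 1) p.1.1 p.1.2 (rsuPos lamR p.2 k) :=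
      hm.comp (measurable_fst.prodMk ((hrsu k).comp measurable_snd))
    have h1 := (indepFun_iff_map_prod_eq_prod_map_map hXB.aemeasurable
      h.phase.aemeasurable).1 h.indep_phase
    have h2 := lintegral_map' (μ := P) (g := fun ω => (((fun i => X i ω), (fun i => B i ω)), U ω))
      hmk.aemeasurable (hXB.aemeasurable.prodMk h.phase.aemeasurable)
    rw [h1, lintegral_prod_symm' _ hmk, h.phase.map_eq] at h2
    rw [← h2]
    refine lintegral_congr fun u => ?_
    rw [lintegral_map (by exact hmk.comp (measurable_id.prodMk measurable_const)) hXB]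
    rfl
  have hmΦ := h.measurable_lintegral_coverCount d (measurableSet_Ico (a := (0 : ℝ)) (b := 1))
  simp only [clusterSum_numRSU]
  have hmt : ∀ k : ℤ, AEMeasurable (fun ω => coverCount d (Set.Ico 0 1) (fun i => X i ω)
      (fun i => B i ω) (rsuPos lamR (U ω) k)) P := fun k =>
    hm.comp_aemeasurable (hXB.aemeasurable.prodMk
      ((hrsu k).comp_aemeasurable h.phase.aemeasurable))
  rw [lintegral_tsum hmt, tsum_congr hk]
  -- The unit cells of the phase unfold to the whole line, and rescaling by the RSU spacing produces
  -- `lamR`.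
  rw [← lintegral_eq_tsum_Ico fun v => Φ (Set.Ico 0 1) (v * lamR⁻¹),
    lintegral_comp_mul_right hmΦ hlamR, lintegral_eq_tsum_Ico (Φ (Set.Ico 0 1))]
  congr 1
  -- Stationarity trades the translate of the location for one of the window; summing over k then
  -- removes the window.
  have hs : ∀ (k : ℤ) (u : ℝ), Φ (Set.Ico 0 1) (k + u) =
      Φ ((· + (k : ℝ)) ⁻¹' Set.Ico 0 1) u := fun k u => by
    rw [hΦ]
    simp only
    rw [h.lintegral_coverCount_add hlam d measurableSet_Ico k]
    simp
  have hpre : ∀ k : ℤ, MeasurableSet ((· + (k : ℝ)) ⁻¹' Set.Ico (0 : ℝ) 1) := fun k =>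
    measurable_add_const _ measurableSet_Ico
  simp only [hs]
  rw [← lintegral_tsum fun k => (h.measurable_lintegral_coverCount d (hpre k)).aemeasurable]
  refine lintegral_congr fun u => ?_
  rw [← lintegral_tsum fun k => (measurable_coverCount h.measurable_loc h.measurable_marks
    measurable_const d (hpre k)).aemeasurable]
  exact lintegral_congr fun ω => tsum_coverCount d _ _ u

/-! ### Clusters reaching a fixed location -/

lemma measure_mark_false (h : IsHighway P X B U lamV γ) (i : ℕ) :
    P {ω | B i ω = false} = 1 - ENNReal.ofReal γ := by
  have hm : MeasurableSet {ω | B i ω = true} := h.measurable_mark i (measurableSet_singleton _)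
  rw [← h.mark i, ← prob_compl_eq_one_sub hm]
  congr 1
  ext ω
  simp

/-- The probability that no vehicle of a finite set is capable. -/
lemma measure_forall_mark_false (h : IsHighway P X B U lamV γ) {S : Set ℕ} (hS : S.Finite) :
    P {ω | ∀ i ∈ S, B i ω = false} = (1 - ENNReal.ofReal γ) ^ S.encard.toNat := by
  have := h.indep_marks.measure_inter_preimage_eq_mul hS.toFinset (sets := fun _ => {false})
    (fun _ _ => measurableSet_singleton _)
  have hp : ∀ i, P (B i ⁻¹' {false}) = 1 - ENNReal.ofReal γ := fun i => h.measure_mark_false i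
  rw [Finset.prod_congr rfl fun i _ => hp i, Finset.prod_const] at this
  rw [hS.encard_eq_coe_toFinset_card, ENat.toNat_natCast, ← this]
  congr 1
  ext ω
  simp

/-- The probability that no capable vehicle is within distance `d` of `t`. -/
lemma measure_no_capable (h : IsHighway P X B U lamV γ) (hlam : 0 ≤ lamV) (hγ₀ : 0 ≤ γ)
    (hγ₁ : γ ≤ 1) (hd : 0 ≤ d) (t : ℝ) :
    P {ω | ∀ i, X i ω ∈ Set.Icc (t - d) (t + d) → B i ω = false} =
      ENNReal.ofReal (Real.exp (-(2 * γ * lamV * d))) := by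
  set E : Set ((ℕ → ℝ) × (ℕ → Bool)) :=
    {p | ∀ i, p.1 i ∈ Set.Icc (t - d) (t + d) → p.2 i = false}
  have hmE : MeasurableSet E :=
    measurableSet_setOfPred.2 <| Measurable.forall fun i =>
      (measurableSet_setOfPred.1 (((measurable_pi_apply i).comp measurable_fst)
        measurableSet_Icc)).imp (measurable_mark_eq measurable_snd i false)
  have hmI : Measurable (E.indicator (1 : (ℕ → ℝ) × (ℕ → Bool) → ℝ≥0∞)) :=
    measurable_one.indicator hmE
  have h1 := h.lintegral_eq (F := fun x b => E.indicator 1 (x, b)) hmI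
  have hl : ∫⁻ ω, E.indicator 1 ((fun i => X i ω), (fun i => B i ω)) ∂P =
      P {ω | ∀ i, X i ω ∈ Set.Icc (t - d) (t + d) → B i ω = false} := by
    have := lintegral_indicator_one (μ := P) ((h.measurable_loc.prodMk h.measurable_marks) hmE)
    exact this
  rw [← hl, h1]
  have hv : volume (Set.Icc (t - d) (t + d)) = ENNReal.ofReal (2 * d) := by
    rw [Real.volume_Icc]; congr 1; ring
  -- Given n vehicles in the interval, none is capable with probability (1 - γ)^n, hence the
  -- generating function at 1 - γ.
  have h2 := h.poisson.lintegral_pow_count hlam (A := Set.Icc (t - d) (t + d)) measurableSet_Icc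
    (by rw [hv]; exact ENNReal.ofReal_ne_top) (q := 1 - γ) (by linarith)
  rw [hv, ENNReal.toReal_ofReal (by positivity)] at h2
  rw [show 2 * γ * lamV * d = (1 - (1 - γ)) * (lamV * (2 * d)) by ring, ← h2]
  refine lintegral_congr_ae ?_
  filter_upwards [h.poisson.ae_finite hlam] with ω hω
  have hmx : Measurable fun b : ℕ → Bool =>
      E.indicator (1 : (ℕ → ℝ) × (ℕ → Bool) → ℝ≥0∞) ((fun i => X i ω), b) :=
    hmI.comp (measurable_const.prodMk measurable_id)
  rw [lintegral_map hmx h.measurable_marks, count, ENNReal.ofReal_sub _ hγ₀, ENNReal.ofReal_one,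
    ← h.measure_forall_mark_false (hω (t - d) (t + d)), ← lintegral_indicator_one]
  · rfl
  · exact measurableSet_setOfPred.2 <| Measurable.forall fun i => measurable_const.imp
      (measurable_mark_eq h.measurable_marks i false)

lemma le_lintegral_coverCount (h : IsHighway P X B U lamV γ) (hlam : 0 ≤ lamV) (hγ₀ : 0 ≤ γ)
    (hγ₁ : γ ≤ 1) (hd : 0 < d) (t : ℝ) :
    ENNReal.ofReal (1 - Real.exp (-(2 * γ * lamV * d))) ≤
      ∫⁻ ω, coverCount d Set.univ (fun i => X i ω) (fun i => B i ω) t ∂P := by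
  classical
  have hm : MeasurableSet {ω | ∀ i, X i ω ∈ Set.Icc (t - d) (t + d) → B i ω = false} :=
    measurableSet_setOfPred.2 <| Measurable.forall fun i =>
      (measurableSet_setOfPred.1 (h.poisson.measurable i measurableSet_Icc)).imp
        (measurable_mark_eq h.measurable_marks i false)
  rw [ENNReal.ofReal_sub _ (Real.exp_pos _).le, ENNReal.ofReal_one,
    ← h.measure_no_capable hlam hγ₀ hγ₁ hd.le t, ← prob_compl_eq_one_sub hm,
    ← lintegral_indicator_one hm.compl]
  refine lintegral_mono_ae ?_
  filter_upwards [h.poisson.ae_finite hlam, h.poisson.ae_exists_gap hlam hd] with ω h1 h2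
  rw [Set.indicator_apply]
  split_ifs with hω
  · simp only [Set.mem_compl_iff, Set.mem_ofPred_eq, not_forall, Bool.not_eq_false] at hω
    obtain ⟨i, hi, hB⟩ := hω
    exact one_le_coverCount h1 h2 hB (abs_le.2 ⟨by linarith [hi.1], by linarith [hi.2]⟩)
  · exact zero_le

lemma lintegral_coverCount_le (h : IsHighway P X B U lamV γ) (hlam : 0 ≤ lamV) (t : ℝ) :
    ∫⁻ ω, coverCount d Set.univ (fun i => X i ω) (fun i => B i ω) t ∂P ≤
      ENNReal.ofReal lamV * ENNReal.ofReal (2 * d) := by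
  have hv : volume (Set.Icc (t - d) (t + d)) = ENNReal.ofReal (2 * d) := by
    rw [Real.volume_Icc]; congr 1; ring
  rw [← hv, ← h.poisson.lintegral_count hlam measurableSet_Icc
    (by rw [hv]; exact ENNReal.ofReal_ne_top)]
  refine lintegral_mono_ae ?_
  filter_upwards [h.poisson.ae_injective hlam] with ω hω
  exact coverCount_le hω _ t

/-! ### The intensity of clusters -/

/-- Given the locations, the probability that a vehicle is the rearmost one of a cluster. -/
lemma measure_isRear_le (h : IsHighway P X B U lamV γ) (hγ₀ : 0 ≤ γ) (hγ₁ : γ ≤ 1) {x : ℕ → ℝ}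
    (hfin : ∀ a b : ℝ, {i | x i ∈ Set.Icc a b}.Finite) (i : ℕ) :
    P {ω | IsRear d x (fun i => B i ω) i} ≤ ENNReal.ofReal (γ * (1 - γ)) +
      ENNReal.ofReal (γ ^ 2) * {x : ℕ → ℝ | ∀ k, x k ∉ Set.Ico (x i - d) (x i)}.indicator 1 x := by
  -- Writing γ = γ(1 - γ) + γ² in the isolated case lets the term γ(1 - γ) serve both cases.
  by_cases hne : ∃ k, x k ∈ Set.Ico (x i - d) (x i)
  · obtain ⟨p, hpi, hp⟩ := exists_legacy_of_isRear hfin hne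
    have hind := (h.indep_marks.indepFun hpi.symm).measure_inter_preimage_eq_mul {true} {false}
      (measurableSet_singleton _) (measurableSet_singleton _)
    refine le_trans ?_ le_self_add
    calc P {ω | IsRear d x (fun i => B i ω) i} ≤ P (B i ⁻¹' {true} ∩ B p ⁻¹' {false}) :=
          measure_mono fun ω hω => ⟨hω.1, hp (fun i => B i ω) hω⟩
      _ = P {ω | B i ω = true} * P {ω | B p ω = false} := hind
      _ = ENNReal.ofReal (γ * (1 - γ)) := by
          rw [h.mark, h.measure_mark_false, ENNReal.ofReal_mul hγ₀, ENNReal.ofReal_sub _ hγ₀,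
            ENNReal.ofReal_one]
  · rw [Set.indicator_of_mem (show x ∈ {x : ℕ → ℝ | ∀ k, x k ∉ Set.Ico (x i - d) (x i)} from
      not_exists.1 hne), Pi.one_apply, mul_one, ← ENNReal.ofReal_add (by nlinarith) (by positivity)]
    calc P {ω | IsRear d x (fun i => B i ω) i} ≤ P {ω | B i ω = true} :=
          measure_mono fun ω hω => hω.1
      _ = ENNReal.ofReal (γ * (1 - γ) + γ ^ 2) := by rw [h.mark]; congr 1; ring

end IsHighway

/-- Vehicles with no vehicle close behind are counted by cells followed by an empty interval. -/
lemma tsum_isolated_le (x : ℕ → ℝ) (d : ℝ) {n : ℕ} (hn : 0 < n) :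
    ∑' i, (Set.Ico (0 : ℝ) 1).indicator 1 (x i) *
      {x : ℕ → ℝ | ∀ k, x k ∉ Set.Ico (x i - d) (x i)}.indicator (1 : (ℕ → ℝ) → ℝ≥0∞) x ≤
    ∑ k ∈ Finset.range n, (({i | x i ∈ cell 0 n k}.encard : ℕ∞) : ℝ≥0∞) *
      ({0} : Set ℕ∞).indicator 1
        {i | x i ∈ Set.Ico ((k : ℝ) / n + 1 / n - d) ((k : ℝ) / n)}.encard := by
  classical
  simp only [encard_eq_tsum_ite, ← ENNReal.tsum_mul_right]
  rw [← Summable.tsum_finsetSum fun _ _ => ENNReal.summable]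
  refine ENNReal.tsum_le_tsum fun i => ?_
  simp only [Set.indicator_apply, Pi.one_apply]
  split_ifs with h1 h2
  · obtain ⟨k, hk, hik⟩ := exists_mem_cell hn (a := 0) (by rwa [zero_add])
    refine le_trans ?_ (Finset.single_le_sum (fun _ _ => zero_le) (Finset.mem_range.2 hk))
    rw [if_pos hik, if_pos, one_mul]
    refine Set.encard_eq_zero.2 (Set.eq_empty_of_forall_notMem fun j hj => h2 j ⟨?_, ?_⟩)
    · have := hj.1
      have := hik.2
      linarith
    · have := hj.2
      have := hik.1
      linarith
  all_goals simp

namespace IsHighway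

/-- A discretised Mecke formula: a cell and the shortened interval behind it have independent
counts. The loss of 1/n in length vanishes in the limit. -/
lemma clusterIntensity_le_of_mesh (h : IsHighway P X B U lamV γ) (hlam : 0 ≤ lamV) (hγ₀ : 0 ≤ γ)
    (hγ₁ : γ ≤ 1) {n : ℕ} (hn : 0 < n) :
    clusterIntensity P X B d ≤ ENNReal.ofReal
      (γ * (1 - γ) * lamV + γ ^ 2 * (lamV * Real.exp (-(lamV * (d - 1 / n))))) := by
  classical
  have hF : Measurable (Function.uncurry fun x b =>
      clusterSum d x b fun _ => 1) :=
    Measurable.tsum fun i => Measurable.ite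
      (measurableSet_isRear_and_mem measurable_fst measurable_snd d measurableSet_Ico i)
      measurable_const measurable_const
  rw [clusterIntensity, h.lintegral_eq hF]
  have hC : ∀ k : ℕ, MeasurableSet (Set.Ico ((k : ℝ) / n + 1 / n - d) ((k : ℝ) / n)) :=
    fun k => measurableSet_Ico
  have hCv : ∀ k : ℕ, volume (Set.Ico ((k : ℝ) / n + 1 / n - d) ((k : ℝ) / n)) =
      ENNReal.ofReal (d - 1 / n) := fun k => by
    rw [Real.volume_Ico]; congr 1; ring
  have hI : volume (Set.Ico (0 : ℝ) 1) = 1 := by simp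
  have hmc : ∀ {A : Set ℝ}, MeasurableSet A → Measurable fun ω => (count X A ω : ℝ≥0∞) :=
    fun hA => Measurable.comp (g := fun n : ℕ∞ => (n : ℝ≥0∞)) measurable_from_top
      (measurable_count h.poisson.measurable hA)
  have hmi : ∀ k : ℕ, MeasurableSet {ω | count X
      (Set.Ico ((k : ℝ) / n + 1 / n - d) ((k : ℝ) / n)) ω = 0} := fun k =>
    measurable_count h.poisson.measurable (hC k) (measurableSet_singleton 0)
  have hmf : ∀ k : ℕ, Measurable fun ω => (count X (cell 0 n k) ω : ℝ≥0∞) * {ω | count X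
      (Set.Ico ((k : ℝ) / n + 1 / n - d) ((k : ℝ) / n)) ω = 0}.indicator 1 ω := fun k =>
    (hmc (measurableSet_cell 0 n k)).mul (measurable_one.indicator (hmi k))
  calc ∫⁻ ω, ∫⁻ b, clusterSum d (fun i => X i ω) b (fun _ => 1) ∂(P.map fun ω i => B i ω) ∂P
      ≤ ∫⁻ ω, (ENNReal.ofReal (γ * (1 - γ)) * count X (Set.Ico 0 1) ω + ENNReal.ofReal (γ ^ 2) *
          ∑ k ∈ Finset.range n, (count X (cell 0 n k) ω : ℝ≥0∞) * {ω | count X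
            (Set.Ico ((k : ℝ) / n + 1 / n - d) ((k : ℝ) / n)) ω = 0}.indicator 1 ω) ∂P := by
        refine lintegral_mono_ae ?_
        filter_upwards [h.poisson.ae_finite hlam] with ω hω
        have hms : ∀ i, MeasurableSet {b : ℕ → Bool |
            IsRear d (fun i => X i ω) b i ∧ X i ω ∈ Set.Ico (0 : ℝ) 1} := fun i =>
          measurableSet_isRear_and_mem measurable_const measurable_id d measurableSet_Ico i
        have hi : ∀ i, ∫⁻ b, (if IsRear d (fun i => X i ω) b i ∧ X i ω ∈ Set.Ico (0 : ℝ) 1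
            then (1 : ℝ≥0∞) else 0) ∂(P.map fun ω i => B i ω) ≤
            (Set.Ico (0 : ℝ) 1).indicator 1 (X i ω) * (ENNReal.ofReal (γ * (1 - γ)) +
              ENNReal.ofReal (γ ^ 2) * {x : ℕ → ℝ | ∀ k, x k ∉ Set.Ico (x i - d) (x i)}.indicator 1
                fun i => X i ω) := fun i => by
          by_cases hx : X i ω ∈ Set.Ico (0 : ℝ) 1
          · rw [Set.indicator_of_mem hx, Pi.one_apply, one_mul]
            refine le_trans (le_of_eq ?_) (h.measure_isRear_le hγ₀ hγ₁ hω i)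
            have hr : MeasurableSet {b : ℕ → Bool | IsRear d (fun i => X i ω) b i} :=
              measurableSet_setOfPred.2 (measurable_isRear measurable_const measurable_id d i)
            simp only [hx, and_true]
            have he := Measure.map_apply h.measurable_marks hr (μ := P)
            rw [← lintegral_indicator_one hr] at he
            exact he
          · simp [hx]
        simp only [clusterSum]
        rw [lintegral_tsum fun i => (Measurable.ite (hms i) measurable_const
          measurable_const).aemeasurable]
        refine (ENNReal.tsum_le_tsum hi).trans ?_
        have h1 : ∑' i, (Set.Ico (0 : ℝ) 1).indicator (1 : ℝ → ℝ≥0∞) (X i ω) =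
            count X (Set.Ico 0 1) ω := by
          rw [count, encard_eq_tsum_ite]
          simp only [Set.indicator_apply, Pi.one_apply]
        simp only [mul_add]
        rw [ENNReal.tsum_add, ENNReal.tsum_mul_right, h1, mul_comm]
        refine add_le_add le_rfl ?_
        simp only [mul_left_comm _ (ENNReal.ofReal (γ ^ 2))]
        rw [ENNReal.tsum_mul_left]
        refine mul_le_mul_right ((tsum_isolated_le (fun i => X i ω) d hn).trans (le_of_eq ?_)) _
        refine Finset.sum_congr rfl fun k _ => ?_
        simp [count, Set.indicator_apply]
    _ = ENNReal.ofReal (γ * (1 - γ)) * ENNReal.ofReal lamV + ENNReal.ofReal (γ ^ 2) *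
          ∑ k ∈ Finset.range n, ENNReal.ofReal lamV * ENNReal.ofReal (1 / n) *
            ENNReal.ofReal (Real.exp (-(lamV * (ENNReal.ofReal (d - 1 / n)).toReal))) := by
        rw [lintegral_add_left ((hmc measurableSet_Ico).const_mul _),
          lintegral_const_mul _ (hmc measurableSet_Ico),
          h.poisson.lintegral_count hlam measurableSet_Ico (by simp), hI, mul_one,
          lintegral_const_mul _ (Finset.measurable_fun_sum _ fun k _ => hmf k),
          lintegral_finsetSum _ fun k _ => hmf k]
        congr 2
        refine Finset.sum_congr rfl fun k _ => ?_
        rw [h.poisson.lintegral_count_mul_indicator hlam (measurableSet_cell 0 n k)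
          (by rw [volume_cell]; exact ENNReal.ofReal_ne_top) (hC k)
          (by rw [hCv]; exact ENNReal.ofReal_ne_top), volume_cell, hCv]
        rw [Set.disjoint_left]
        intro t h1 h2
        have := h1.1
        have := h2.2
        linarith
    _ ≤ ENNReal.ofReal
          (γ * (1 - γ) * lamV + γ ^ 2 * (lamV * Real.exp (-(lamV * (d - 1 / n))))) := by
        have h1 : 0 ≤ γ * (1 - γ) := mul_nonneg hγ₀ (by linarith)
        rw [Finset.sum_const, Finset.card_range, nsmul_eq_mul, ← ENNReal.ofReal_natCast,
          ← ENNReal.ofReal_mul hlam, ← ENNReal.ofReal_mul (by positivity),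
          ← ENNReal.ofReal_mul (by positivity), ← ENNReal.ofReal_mul (by positivity),
          ← ENNReal.ofReal_mul (by positivity), ← ENNReal.ofReal_add (by positivity) (by positivity)]
        refine ENNReal.ofReal_le_ofReal (add_le_add le_rfl
          (mul_le_mul_of_nonneg_left ?_ (by positivity)))
        -- If 1/n > d the shortened interval is empty, and its length 0 still dominates d - 1/n.
        have h2 : d - 1 / n ≤ (ENNReal.ofReal (d - 1 / n)).toReal := by
          rw [ENNReal.toReal_ofReal']; exact le_max_left _ _
        rw [show (n : ℝ) * (lamV * (1 / n) *
          Real.exp (-(lamV * (ENNReal.ofReal (d - 1 / n)).toReal))) =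
          lamV * Real.exp (-(lamV * (ENNReal.ofReal (d - 1 / n)).toReal)) by field_simp]
        gcongr

/-- The mean number of clusters per unit length. -/
lemma clusterIntensity_le (h : IsHighway P X B U lamV γ) (hlam : 0 ≤ lamV) (hγ₀ : 0 ≤ γ)
    (hγ₁ : γ ≤ 1) :
    clusterIntensity P X B d ≤
      ENNReal.ofReal (γ * lamV * (1 - γ + γ * Real.exp (-(lamV * d)))) := by
  have ht : Filter.Tendsto (fun n : ℕ => ENNReal.ofReal (γ * (1 - γ) * lamV +
      γ ^ 2 * (lamV * Real.exp (-(lamV * (d - 1 / ((n : ℝ) + 1))))))) Filter.atTop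
      (nhds (ENNReal.ofReal (γ * (1 - γ) * lamV +
        γ ^ 2 * (lamV * Real.exp (-(lamV * (d - 0))))))) := by
    refine ENNReal.tendsto_ofReal (Filter.Tendsto.const_add _ (Filter.Tendsto.const_mul _
      (Filter.Tendsto.const_mul _ ((Real.continuous_exp.tendsto _).comp
        (Filter.Tendsto.neg (Filter.Tendsto.const_mul _ (Filter.Tendsto.const_sub _ ?_)))))))
    exact tendsto_one_div_add_atTop_nhds_zero_nat
  rw [show γ * lamV * (1 - γ + γ * Real.exp (-(lamV * d))) = γ * (1 - γ) * lamV +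
    γ ^ 2 * (lamV * Real.exp (-(lamV * (d - 0)))) by rw [sub_zero]; ring]
  refine ge_of_tendsto' ht fun n => ?_
  have := h.clusterIntensity_le_of_mesh (d := d) hlam hγ₀ hγ₁ n.succ_pos
  push_cast at this
  exact this

end IsHighway

/-- Used for positivity: zero intensity would make the numerator vanish as well. -/
lemma clusterSum_eq_zero {x : ℕ → ℝ} {c : ℕ → Bool} (h : clusterSum d x c (fun _ => 1) = 0)
    (f : ℕ → ℝ≥0∞) : clusterSum d x c f = 0 := by
  classical
  rw [clusterSum, ENNReal.tsum_eq_zero] at h ⊢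
  intro i
  have := h i
  by_cases hi : IsRear d x c i ∧ x i ∈ Set.Ico (0 : ℝ) 1
  · simp [hi] at this
  · exact if_neg hi

end

end Highway

/-! ### Quotient of the two estimates -/

theorem mainTheorem5 {Ω : Type*} [MeasurableSpace Ω] (P : Measure Ω) [IsProbabilityMeasure P]
    (X : ℕ → Ω → ℝ) (B : ℕ → Ω → Bool) (U : Ω → ℝ) (lamV lamR γ d : ℝ)
    (hlamV : 0 < lamV) (hlamR : 0 < lamR) (hd : 0 < d) (hγ₀ : 0 < γ) (hγ₁ : γ ≤ 1)
    (hmodel : Highway.IsHighway P X B U lamV γ) :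
    (Highway.clusterIntensity P X B d ≠ 0 ∧ Highway.clusterIntensity P X B d ≠ ∞) ∧
    Highway.meanRSU P X B U d lamR ≠ ∞ ∧
    (1 - Real.exp (-(2 * γ * lamV * d))) /
        (γ * lamV * lamR⁻¹ * (1 - γ + γ * Real.exp (-(γ * lamV * d)))) ≤
      (Highway.meanRSU P X B U d lamR).toReal ∧
    (γ = 1 →
      (Real.exp (lamV * d) - Real.exp (-(lamV * d))) / (lamV * lamR⁻¹) ≤
        (Highway.meanRSU P X B U d lamR).toReal ∧
      (Real.exp (lamV * d) - Real.exp (-(lamV * d))) / (lamV * lamR⁻¹) =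
        2 * Real.sinh (lamV * d) / (lamV * lamR⁻¹)) := by
  classical
  set I := Highway.clusterIntensity P X B d with hI
  set N := ∫⁻ ω, Highway.clusterSum d (fun i => X i ω) (fun i => B i ω)
    (fun i => (Highway.numRSU d lamR (fun i => X i ω) (fun i => B i ω) (U ω) i : ℝ≥0∞)) ∂P with hN
  have hunit : volume.restrict (Set.Ico (0 : ℝ) 1) Set.univ = 1 := by simp
  have hNeq := hmodel.lintegral_clusterSum_numRSU hlamV.le hlamR d
  rw [← hN] at hNeq
  have hexp : Real.exp (-(2 * γ * lamV * d)) < 1 := 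
    (Real.exp_lt_exp.2 (neg_lt_zero.2 (by positivity))).trans_eq Real.exp_zero
  have hNge : ENNReal.ofReal (lamR * (1 - Real.exp (-(2 * γ * lamV * d)))) ≤ N := by
    rw [hNeq, ENNReal.ofReal_mul hlamR.le]
    gcongr
    calc ENNReal.ofReal (1 - Real.exp (-(2 * γ * lamV * d)))
        = ∫⁻ _ in Set.Ico (0 : ℝ) 1, ENNReal.ofReal (1 - Real.exp (-(2 * γ * lamV * d))) := by
          rw [lintegral_const, hunit, mul_one]
      _ ≤ _ := lintegral_mono fun u =>
          hmodel.le_lintegral_coverCount hlamV.le hγ₀.le hγ₁ hd u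
  have hNtop : N ≠ ∞ := by
    rw [hNeq]
    refine ENNReal.mul_ne_top ENNReal.ofReal_ne_top (ne_top_of_le_ne_top ?_
      (lintegral_mono fun u => hmodel.lintegral_coverCount_le (d := d) hlamV.le u))
    rw [lintegral_const, hunit, mul_one]
    exact ENNReal.mul_ne_top ENNReal.ofReal_ne_top ENNReal.ofReal_ne_top
  have hIle := hmodel.clusterIntensity_le (d := d) hlamV.le hγ₀.le hγ₁
  rw [← hI] at hIle
  have hItop : I ≠ ∞ := ne_top_of_le_ne_top ENNReal.ofReal_ne_top hIle
  have hI0 : I ≠ 0 := by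
    intro h0
    have hm : Measurable fun ω => Highway.clusterSum d (fun i => X i ω) (fun i => B i ω)
        (fun _ => 1) :=
      Measurable.tsum fun i => Measurable.ite (Highway.measurableSet_isRear_and_mem
        hmodel.measurable_loc hmodel.measurable_marks d measurableSet_Ico i)
        measurable_const measurable_const
    have hae := (lintegral_eq_zero_iff hm).1 h0
    have : N = 0 := by
      rw [hN, ← lintegral_zero (μ := P)]
      refine lintegral_congr_ae ?_
      filter_upwards [hae] with ω hω
      exact Highway.clusterSum_eq_zero hω _
    rw [this] at hNge
    have := ENNReal.ofReal_eq_zero.1 (le_antisymm hNge zero_le)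
    nlinarith
  have hM : Highway.meanRSU P X B U d lamR = N / I := rfl
  have hMtop : N / I ≠ ∞ := ENNReal.div_ne_top hNtop hI0
  have hbound : (1 - Real.exp (-(2 * γ * lamV * d))) /
        (γ * lamV * lamR⁻¹ * (1 - γ + γ * Real.exp (-(γ * lamV * d)))) ≤ (N / I).toReal := by
    have hN' : lamR * (1 - Real.exp (-(2 * γ * lamV * d))) ≤ N.toReal :=
      (ENNReal.ofReal_le_iff_le_toReal hNtop).1 hNge
    have hpos : 0 < 1 - γ + γ * Real.exp (-(γ * lamV * d)) := by
      have := mul_pos hγ₀ (Real.exp_pos (-(γ * lamV * d)))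
      linarith
    have hI' : I.toReal ≤ γ * lamV * (1 - γ + γ * Real.exp (-(γ * lamV * d))) := by
      refine ENNReal.toReal_le_of_le_ofReal (by positivity)
        (hIle.trans (ENNReal.ofReal_le_ofReal ?_))
      -- The isolation probability is exp(-lamV d); since γ ≤ 1, the stated exp(-γ lamV d) is
      -- larger.
      have : γ * lamV * d ≤ lamV * d := by
        have := mul_pos hlamV hd
        nlinarith
      gcongr
    have hIpos : 0 < I.toReal := ENNReal.toReal_pos hI0 hItop
    rw [ENNReal.toReal_div]
    calc _ = lamR * (1 - Real.exp (-(2 * γ * lamV * d))) /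
          (γ * lamV * (1 - γ + γ * Real.exp (-(γ * lamV * d)))) := by
          field_simp
      _ ≤ N.toReal / I.toReal := by
          gcongr
  refine ⟨⟨hI0, hItop⟩, hM ▸ hMtop, hM ▸ hbound, fun hγ => ⟨?_, ?_⟩⟩
  · rw [hM]
    refine le_trans (le_of_eq ?_) hbound
    rw [hγ, show -(2 * 1 * lamV * d) = -(lamV * d) + -(lamV * d) by ring, Real.exp_add,
      show -(1 * lamV * d) = -(lamV * d) by ring, Real.exp_neg]
    have := Real.exp_pos (lamV * d)
    field_simp
    ring
  · rw [Real.sinh_eq]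
    ring
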